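/- **Setting.** Let $\mathcal S_k:\mathcal H_k\to\mathcal G_k$ $(k\in\mathbb N=\{1,2,\dots\})$ be compact linear operators between (real or complex) Hilbert spaces, $\mathcal H_k$ separable, and let $S=\{S_d\}_{d\in\mathbb N}$ with $S_d=\bigotimes_{k=1}^d\mathcal S_k:\bigotimes_{k=1}^d\mathcal H_k\to\bigotimes_{k=1}^d\mathcal G_k$ (Hilbert space tensor products). Let $\lambda(k,1)\ge\lambda(k,2)\ge\dots\ge0$ be the eigenvalues of $\mathcal S_k^*\mathcal S_k$, with multiplicity (continued by zeros if there are only finitely many nonzero ones). For $n\ge1$ let $e(n,S_d)$ be the infimum of $\sup_{\|f\|\le1}\|S_df-\phi(L_1(f),\dots,L_n(f))\|$ over all continuous linear functionals $L_1,\dots,L_n$ and all measurable mappings $\phi$, and let $e(0,S_d)=\|S_d\|$. For the absolute (ABS) and the normalized (NOR) error criterion the information complexity is $n(\varepsilon,S_d)=\min\{n\ge0: e(n,S_d)\le\varepsilon\,\mathrm{CRI}_d\}$ with $\mathrm{CRI}_d=1$ and $\mathrm{CRI}_d=e(0,S_d)$, respectively. $S$ is called, with $\varepsilon$ ranging over $(0,1)$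 and $d$ over $\mathbb N$, * SPT if $n(\varepsilon,S_d)\le C\varepsilon^{-p}$ for all $\varepsilon,d$, for some $C,p\ge0$; the exponent $p^*$ is the infimum of all such $p$; * PT if $n(\varepsilon,S_d)\le Cd^q\varepsilon^{-p}$ for all $\varepsilon,d$, for some $C,p,q\ge0$; * QPT if $n(\varepsilon,S_d)\le C\exp(t(1+\ln d)(1+\ln\varepsilon^{-1}))$ for all $\varepsilon,d$, for some $C,t>0$; the exponent $t^*$ is the infimum of all such $t$; * $(s,t)$-WT (for fixed $s,t>0$) if $\ln n(\varepsilon,S_d)/(\varepsilon^{-s}+d^t)\to0$ as $\varepsilon^{-1}+d\to\infty$; WT if it is $(1,1)$-WT; UWT if it is $(\alpha,\beta)$-WT for all $\alpha,\beta>0$; * to suffer from the curse of dimensionality if there are $C,\varepsilon_0,\alpha>0$ such that for all $0<\varepsilon\le\varepsilon_0$ one has $n(\varepsilon,S_d)\ge C(1+\alpha)^d$ for infinitely many $d$. $S$ has Property (P) if (1) $\lambda(k,1)=1$ for all $k$; (2) $h_k=\lambda(k,2)/\lambda(k,1)\in(0,1]$ is nonincreasing in $k$; (3) there is a $\tau>0$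 with $$\sup_{k}H(k,\tau)=H(1,\tau)<\infty,\qquad H(k,\tau)=\sum_{j\ge2}\Big(\frac{\lambda(k,j)}{\lambda(k,2)}\Big)^{\tau}.\qquad(*)$$ Put $\tau_0=\inf\{\tau>0:\ \tau\text{ satisfies }(*)\}$ and $\tau_1=\inf\{\tau>0: H(1,\tau)<\infty\}\le\tau_0$. **Theorem.** Let $S$ have Property (P), and let $A_*=\liminf_{d\to\infty}\frac{\ln h_d^{-1}}{\ln d}\in[0,\infty]$, with the convention $2/\infty=0$. Then, both for ABS and for NOR: (i) $S$ is SPT iff $A_*>0$. In that case $\max\{2/A_*,2\tau_1\}\le p^*\le\max\{2/A_*,2\tau_0\}$, so that $$p^*=\max\{2/A_*,2\tau_0\}\quad\text{if }\tau_0=\tau_1$$ (for instance if $(*)$ holds for every $\tau>0$ with $H(1,\tau)<\infty$). (ii) $S$ is SPT iff it is PT. (iii) The limit $B=\lim_{d\to\infty}\ln h_d^{-1}\in[0,\infty]$ exists, and $S$ is QPT iff $B>0$, which is equivalent to $h_k\not\equiv1$. In that case $\max\{2/B,2\tau_1\}\le t^*\le\max\{2/B,2\tau_0\}$, so that $t^*=\max\{2/B,2\tau_0\}$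 if $\tau_0=\tau_1$. (iv) $S$ is QPT iff it is UWT; for every $s>0$ and $t\in(0,1]$, $S$ is QPT iff it is $(s,t)$-WT; and $S$ is QPT iff it is WT. (v) $S$ is $(s,t)$-WT for all $s>0$ and $t>1$. (vi) $S$ suffers from the curse of dimensionality iff $h_k\equiv1$. -/

import Mathlib

open Filter Topology
open scoped ENNReal TensorProduct

universe u v w

namespace TensorTractability

noncomputable section

/-! ### Hilbert spaces and their (completed) tensor products

All sequences are indexed from `0`: the factor with index `k` below is the `(k+1)`-st factor, and
the eigenvalue with index `j` is the `(j+1)`-st eigenvalue. The dimension `d`, in contrast, is the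
actual dimension `d ≥ 1`. -/

/-- A bundled Hilbert space over `𝕜`, where `𝕜` is the real or the complex field. -/
structure HilbSp (𝕜 : Type u) [RCLike 𝕜] where
  carrier : Type v
  [normed : NormedAddCommGroup carrier]
  [inner : InnerProductSpace 𝕜 carrier]
  [complete : CompleteSpace carrier]

instance (𝕜 : Type u) [RCLike 𝕜] : CoeSort (HilbSp.{u, v} 𝕜) (Type v) := ⟨HilbSp.carrier⟩

attribute [instance] HilbSp.normed HilbSp.inner HilbSp.complete

variable {𝕜 : Type u} [RCLike 𝕜]

/-- The Hilbert space tensor product: the completion of the algebraic tensor product for the norm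
of the inner product given by `⟪a ⊗ b, x ⊗ y⟫ = ⟪a, x⟫ ⟪b, y⟫` on elementary tensors. -/
def HilbSp.tensor (A B : HilbSp.{u, v} 𝕜) : HilbSp.{u, v} 𝕜 where
  carrier := UniformSpace.Completion (A ⊗[𝕜] B)

/-- `tensorSpace X n = X 0 ⊗ X 1 ⊗ ⋯ ⊗ X n` (that is, `n + 1` factors). -/
def tensorSpace (X : ℕ → HilbSp.{u, v} 𝕜) : ℕ → HilbSp.{u, v} 𝕜
  | 0 => X 0
  | n + 1 => (tensorSpace X n).tensor (X (n + 1))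

/-- `tensorOp T n = T 0 ⊗ T 1 ⊗ ⋯ ⊗ T n`, the continuous linear operator acting on elementary
tensors factor by factor. -/
def tensorOp {X : ℕ → HilbSp.{u, v} 𝕜} {Y : ℕ → HilbSp.{u, w} 𝕜}
    (T : ∀ k, X k →L[𝕜] Y k) : ∀ n, tensorSpace X n →L[𝕜] tensorSpace Y n
  | 0 => T 0
  | n + 1 => (TensorProduct.mapL (tensorOp T n) (T (n + 1))).completion

/-- A linear tensor product problem: compact operators `S k : H k → G k` between Hilbert spaces,
with `H k` separable. The `d`-variate problem is the `d`-fold tensor product `P.problem d`. -/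
structure TensorProductProblem (𝕜 : Type u) [RCLike 𝕜] where
  H : ℕ → HilbSp.{u, v} 𝕜
  G : ℕ → HilbSp.{u, w} 𝕜
  separable : ∀ k, TopologicalSpace.SeparableSpace (H k)
  S : ∀ k, H k →L[𝕜] G k
  compact : ∀ k, IsCompactOperator (S k)

/-- The `d`-variate solution operator, the tensor product of the first `d` factors (`d ≥ 1`). -/
def TensorProductProblem.problem (P : TensorProductProblem.{u, v, w} 𝕜) (d : ℕ) :
    tensorSpace P.H (d - 1) →L[𝕜] tensorSpace P.G (d - 1) :=
  tensorOp P.S (d - 1)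

/-- The operator `S_k^* S_k` of the `k`-th factor. -/
def TensorProductProblem.W (P : TensorProductProblem.{u, v, w} 𝕜) (k : ℕ) : P.H k →L[𝕜] P.H k :=
  (P.S k).adjoint ∘L P.S k

/-- `(lam j, η j)` are the eigenpairs of `W`, ordered by `lam 0 ≥ lam 1 ≥ ⋯ ≥ 0`: the eigenvectors
of the nonzero eigenvalues are orthonormal, and `W` vanishes on their orthogonal complement. So the
nonzero members of `lam` are the nonzero eigenvalues of `W` with their multiplicities, and `lam` is
continued by zeros if there are only finitely many of these. -/
structure IsEigenSystem {E : Type v} [NormedAddCommGroup E] [InnerProductSpace 𝕜 E]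
    (W : E →L[𝕜] E) (lam : ℕ → ℝ) (η : ℕ → E) : Prop where
  antitone : Antitone lam
  nonneg : ∀ j, 0 ≤ lam j
  eigen : ∀ j, W (η j) = (lam j : 𝕜) • η j
  orthonormal : Orthonormal 𝕜 (fun j : {j : ℕ // lam j ≠ 0} => η j)
  complete : ∀ x : E, (∀ j, lam j ≠ 0 → inner 𝕜 (η j) x = 0) → W x = 0

/-! ### Worst case errors and information complexity -/

section Error

variable {E : Type v} [NormedAddCommGroup E] [InnerProductSpace 𝕜 E]
  {F : Type w} [NormedAddCommGroup F] [InnerProductSpace 𝕜 F]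

/-- The worst case error over the unit ball of an algorithm `A` approximating `T`. -/
def worstCaseError (T : E →L[𝕜] F) (A : E → F) : ℝ≥0∞ :=
  ⨆ f : E, ⨆ _ : ‖f‖ ≤ 1, ‖T f - A f‖ₑ

/-- The `n`-th minimal worst case error: for `n ≥ 1` the infimum over all algorithms
`f ↦ φ (L 0 f, …, L (n-1) f)` with continuous linear functionals `L i` and a (Borel) measurable
mapping `φ`; for `n = 0` only the zero algorithm is used. -/
def minError (T : E →L[𝕜] F) (n : ℕ) : ℝ≥0∞ :=
  if n = 0 then worstCaseError T (fun _ => 0)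
  else ⨅ (L : Fin n → E →L[𝕜] 𝕜) (φ : (Fin n → 𝕜) → F) (_ : @Measurable (Fin n → 𝕜) F _ (borel F) φ),
    worstCaseError T (fun f => φ (fun i => L i f))

/-- The absolute and the normalized error criterion. -/
inductive Criterion
  | ABS
  | NOR

/-- The factor `CRI`: `1` for the absolute criterion, the initial error for the normalized one. -/
def cri (c : Criterion) (T : E →L[𝕜] F) : ℝ≥0∞ :=
  match c with
  | .ABS => 1
  | .NOR => minError T 0

/-- The information complexity `min {n : e(n, T) ≤ ε CRI}`. -/
def infoComplexity (c : Criterion) (T : E →L[𝕜] F) (ε : ℝ) : ℕ :=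
  sInf {n : ℕ | minError T n ≤ ENNReal.ofReal ε * cri c T}

end Error

/-- The information complexity `n(ε, S_d)` of the `d`-variate problem (`d ≥ 1`). -/
def TensorProductProblem.complexity (P : TensorProductProblem.{u, v, w} 𝕜) (c : Criterion)
    (ε : ℝ) (d : ℕ) : ℕ :=
  infoComplexity c (P.problem d) ε

/-! ### Notions of tractability, for an information complexity `N ε d`, `0 < ε < 1`, `d ≥ 1` -/

/-- The bound `n(ε, S_d) ≤ C (ε⁻¹)^p` for all `d` and `ε`. -/
def SPTBound (N : ℝ → ℕ → ℕ) (C p : ℝ) : Prop :=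
  ∀ d : ℕ, 1 ≤ d → ∀ ε : ℝ, 0 < ε → ε < 1 → (N ε d : ℝ) ≤ C * ε⁻¹ ^ p

/-- Strong polynomial tractability. -/
def SPT (N : ℝ → ℕ → ℕ) : Prop := ∃ C p : ℝ, 0 ≤ C ∧ 0 ≤ p ∧ SPTBound N C p

/-- The exponent of strong polynomial tractability (meaningful if `SPT N`). -/
def sptExponent (N : ℝ → ℕ → ℕ) : ℝ := sInf {p : ℝ | 0 ≤ p ∧ ∃ C : ℝ, 0 ≤ C ∧ SPTBound N C p}

/-- Polynomial tractability. -/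
def PT (N : ℝ → ℕ → ℕ) : Prop :=
  ∃ C p q : ℝ, 0 ≤ C ∧ 0 ≤ p ∧ 0 ≤ q ∧
    ∀ d : ℕ, 1 ≤ d → ∀ ε : ℝ, 0 < ε → ε < 1 → (N ε d : ℝ) ≤ C * (d : ℝ) ^ q * ε⁻¹ ^ p

/-- The bound `n(ε, S_d) ≤ C exp (t (1 + ln d) (1 + ln ε⁻¹))` for all `d` and `ε`. -/
def QPTBound (N : ℝ → ℕ → ℕ) (C t : ℝ) : Prop :=
  ∀ d : ℕ, 1 ≤ d → ∀ ε : ℝ, 0 < ε → ε < 1 →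
    (N ε d : ℝ) ≤ C * Real.exp (t * (1 + Real.log d) * (1 + Real.log ε⁻¹))

/-- Quasi-polynomial tractability. -/
def QPT (N : ℝ → ℕ → ℕ) : Prop := ∃ C t : ℝ, 0 < C ∧ 0 < t ∧ QPTBound N C t

/-- The exponent of quasi-polynomial tractability (meaningful if `QPT N`). -/
def qptExponent (N : ℝ → ℕ → ℕ) : ℝ := sInf {t : ℝ | 0 < t ∧ ∃ C : ℝ, 0 < C ∧ QPTBound N C t}

/-- The passage to the limit `ε⁻¹ + d → ∞` over pairs `(ε, d)` with `0 < ε < 1` and `d ≥ 1`. -/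
def jointLimit : Filter (ℝ × ℕ) :=
  comap (fun x : ℝ × ℕ => x.1⁻¹ + (x.2 : ℝ)) atTop ⊓ 𝓟 {x | 0 < x.1 ∧ x.1 < 1 ∧ 1 ≤ x.2}

/-- `(s, t)`-weak tractability. -/
def STWT (N : ℝ → ℕ → ℕ) (s t : ℝ) : Prop :=
  Tendsto (fun x : ℝ × ℕ => Real.log (N x.1 x.2) / (x.1⁻¹ ^ s + (x.2 : ℝ) ^ t)) jointLimit (𝓝 0)

/-- Uniform weak tractability. -/
def UWT (N : ℝ → ℕ → ℕ) : Prop :=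
  ∀ α β : ℝ, 0 < α → 0 < β →
    Tendsto (fun x : ℝ × ℕ => Real.log (N x.1 x.2) / (x.1⁻¹ ^ α + (x.2 : ℝ) ^ β)) jointLimit (𝓝 0)

/-- Weak tractability. -/
def WT (N : ℝ → ℕ → ℕ) : Prop :=
  Tendsto (fun x : ℝ × ℕ => Real.log (N x.1 x.2) / (x.1⁻¹ + (x.2 : ℝ))) jointLimit (𝓝 0)

/-- The curse of dimensionality. -/
def CurseOfDimensionality (N : ℝ → ℕ → ℕ) : Prop :=
  ∃ C ε₀ α : ℝ, 0 < C ∧ 0 < ε₀ ∧ 0 < α ∧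
    ∀ ε : ℝ, 0 < ε → ε ≤ ε₀ → ∃ᶠ d : ℕ in atTop, C * (1 + α) ^ d ≤ (N ε d : ℝ)

/-! ### Property (P), for the eigenvalues `lam k j` of the factors -/

/-- The quotient of the second and the first eigenvalue of the `k`-th factor. -/
def hRatio (lam : ℕ → ℕ → ℝ) (k : ℕ) : ℝ := lam k 1 / lam k 0

/-- `H(k, τ)`: the sum over all eigenvalues from the second on of the `τ`-th powers of their
quotients by the second eigenvalue. -/
def HSum (lam : ℕ → ℕ → ℝ) (k : ℕ) (τ : ℝ) : ℝ≥0∞ :=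
  ∑' j : ℕ, ENNReal.ofReal ((lam k (j + 1) / lam k 1) ^ τ)

/-- The supremum of `H(k, τ)` over `k` is `H(k, τ)` for the first factor, and is finite. -/
def DominatedByFirst (lam : ℕ → ℕ → ℝ) (τ : ℝ) : Prop :=
  (⨆ k, HSum lam k τ) = HSum lam 0 τ ∧ HSum lam 0 τ < ∞

/-- Property (P). -/
structure PropertyP (lam : ℕ → ℕ → ℝ) : Prop where
  first_eq_one : ∀ k, lam k 0 = 1
  ratio_mem : ∀ k, 0 < hRatio lam k ∧ hRatio lam k ≤ 1
  ratio_antitone : Antitone (hRatio lam)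
  dominated : ∃ τ : ℝ, 0 < τ ∧ DominatedByFirst lam τ

/-- `τ₀`, the infimum of all `τ > 0` as in the last condition of Property (P). -/
def tauZero (lam : ℕ → ℕ → ℝ) : ℝ := sInf {τ : ℝ | 0 < τ ∧ DominatedByFirst lam τ}

/-- The infimum of all `τ > 0` for which `H(k, τ)` is finite for the first factor. -/
def tauFirst (lam : ℕ → ℕ → ℝ) : ℝ := sInf {τ : ℝ | 0 < τ ∧ HSum lam 0 τ < ∞}

/-- `A_* = liminf (ln h_d⁻¹ / ln d)`, with values in `[-∞, ∞]`. -/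
def AStar (lam : ℕ → ℕ → ℝ) : EReal :=
  liminf (fun d : ℕ => ((Real.log (hRatio lam (d - 1))⁻¹ / Real.log d : ℝ) : EReal)) atTop

end

end TensorTractability

open TensorTractability

/-!
All factors have largest eigenvalue `1`, so `‖S_d‖ = 1` and the two error criteria agree. The
operator `S_d† S_d` has the products `∏ k, lam k (j k)`, `j ∈ ℕ^d`, as its eigenvalues, with the
tensor products of the eigenvectors of the factors as eigenvectors
(`exists_singularSystem_tensorOp`). The `n`-th minimal error of an operator is its `n`-th singular
value: the truncated singular value decomposition attains it, and no algorithm does better because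
any `n` functionals vanish at some nonzero `x` in the span of `n + 1` singular vectors, so that `x`
and `-x` are not distinguished. Hence `n(ε, S_d)` is the number of multi-indices `j` with
`∏ k, lam k (j k) > ε ^ 2` (`TensorProductProblem.complexity_eq_spectralCount`).

The rest is counting, with `h k` the second eigenvalue of the `k`-th factor. From above, Markov's
inequality for `τ`-powers gives `n(ε, S_d) ≤ ε ^ (-2 τ) ∏_{k < d} (1 + M h_k ^ τ)` for every `τ`
beyond an admissible one. From below, choosing the second eigenvalue in `m` of the coordinates gives
`n(ε, S_d) ≥ d.choose m` as soon as `ε ^ 2 < h_d ^ m`. The structure `ComplexityBounds` collects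
these bounds, and the theorem follows from it alone:

* For strong polynomial tractability `τ` is fixed, and the product is bounded if `∑ h_k ^ τ < ∞`,
  which holds if `τ > 1 / A_*`. Conversely `n(ε, S_d) ≤ C d ^ q ε ^ (-p)` and `m > q` force
  `A_* ≥ 2 (m - q) / (p m)`; with `m = 1`, `q = 0` this is `p ≥ 2 / A_*`.
* For quasi-polynomial tractability `τ = (t / 2) (1 + ln d)` grows with `d`, which makes
  `h_k ^ τ ≤ 1 / d` for all but finitely many `k` if `t > 2 / B`. Conversely, `d → ∞` and then
  `m → ∞` in the binomial bound give `t ≥ 2 / B`.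
* The lower bounds by `2 τ₁` come from the univariate problem.
* If `h ≡ 1`, then `n(ε, S_d) ≥ 2 ^ d`, which excludes the weak notions with `t ≤ 1` and gives the
  curse; otherwise `B > 0`, and quasi-polynomial tractability implies all the weak notions and
  excludes the curse. For `t > 1` a fixed `τ` gives `ln n(ε, S_d) = O(ln ε⁻¹ + d)`.
-/

namespace TensorTractability

/-! ### Singular systems of bounded operators -/

theorem norm_sq_sum_smul {𝕜 : Type*} [RCLike 𝕜] {E : Type*} [NormedAddCommGroup E]
    [InnerProductSpace 𝕜 E] {ι : Type*} {s : Finset ι} {v : ι → E} (c : ι → 𝕜)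
    (h : ∀ i ∈ s, ∀ j ∈ s, i ≠ j → inner 𝕜 (v i) (v j) = 0) :
    ‖∑ i ∈ s, c i • v i‖ ^ 2 = ∑ i ∈ s, ‖c i‖ ^ 2 * ‖v i‖ ^ 2 := by
  classical
  induction s using Finset.induction_on with
  | empty => simp
  | insert a s ha ih =>
    have h0 : inner 𝕜 (c a • v a) (∑ i ∈ s, c i • v i) = 0 := by
      rw [inner_sum]
      refine Finset.sum_eq_zero fun i hi => ?_
      rw [inner_smul_left, inner_smul_right, h a (by simp) i (by simp [hi])
        (fun hh => ha (hh ▸ hi))]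
      simp
    rw [Finset.sum_insert ha, Finset.sum_insert ha, norm_add_sq (𝕜 := 𝕜), h0,
      ih fun i hi j hj => h i (by simp [hi]) j (by simp [hj]), norm_smul]
    simp
    ring

section SingularSystem

variable {𝕜 : Type*} [RCLike 𝕜]
  {E : Type*} [NormedAddCommGroup E] [InnerProductSpace 𝕜 E] [CompleteSpace E]
  {F : Type*} [NormedAddCommGroup F] [InnerProductSpace 𝕜 F] [CompleteSpace F]
  {ι : Type*}

/-- The vectors `e i`, over an arbitrary index type, are eigenvectors of `T† T` for the eigenvalues
`μ i`; those with `μ i ≠ 0` are orthonormal, and `T` vanishes on their orthogonal complement.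
Nothing is asked of `e i` when `μ i = 0`. -/
structure SingularSystem (T : E →L[𝕜] F) (μ : ι → ℝ) (e : ι → E) : Prop where
  nonneg : ∀ i, 0 ≤ μ i
  norm_eq_one : ∀ i, μ i ≠ 0 → ‖e i‖ = 1
  inner_eq_zero : ∀ i j, μ i ≠ 0 → μ j ≠ 0 → i ≠ j → inner 𝕜 (e i) (e j) = 0
  eigen : ∀ i, μ i ≠ 0 → T.adjoint (T (e i)) = (μ i : 𝕜) • e i
  complete : ∀ x, (∀ i, μ i ≠ 0 → inner 𝕜 (e i) x = 0) → T x = 0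

namespace SingularSystem

variable {T : E →L[𝕜] F} {μ : ι → ℝ} {e : ι → E}

theorem inner_apply (hs : SingularSystem T μ e) {i : ι} (hi : μ i ≠ 0) (x : E) :
    inner 𝕜 (T (e i)) (T x) = (μ i : 𝕜) * inner 𝕜 (e i) x := by
  rw [← ContinuousLinearMap.adjoint_inner_left, hs.eigen i hi, inner_smul_left]
  simp

theorem norm_sq_apply (hs : SingularSystem T μ e) {i : ι} (hi : μ i ≠ 0) :
    ‖T (e i)‖ ^ 2 = μ i := by
  have h := hs.inner_apply hi (e i)
  rw [inner_self_eq_norm_sq_to_K, inner_self_eq_norm_sq_to_K, hs.norm_eq_one i hi] at h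
  have h' : ((‖T (e i)‖ ^ 2 : ℝ) : 𝕜) = ((μ i : ℝ) : 𝕜) := by
    push_cast
    simpa using h
  exact_mod_cast h'

theorem norm_sq_sum (hs : SingularSystem T μ e) {s : Finset ι} (h : ∀ i ∈ s, μ i ≠ 0)
    (c : ι → 𝕜) : ‖∑ i ∈ s, c i • e i‖ ^ 2 = ∑ i ∈ s, ‖c i‖ ^ 2 := by
  rw [norm_sq_sum_smul c fun i hi j hj => hs.inner_eq_zero i j (h i hi) (h j hj)]
  exact Finset.sum_congr rfl fun i hi => by rw [hs.norm_eq_one i (h i hi)]; ring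

theorem norm_sq_apply_sum (hs : SingularSystem T μ e) {s : Finset ι} (h : ∀ i ∈ s, μ i ≠ 0)
    (c : ι → 𝕜) : ‖T (∑ i ∈ s, c i • e i)‖ ^ 2 = ∑ i ∈ s, ‖c i‖ ^ 2 * μ i := by
  simp only [map_sum, map_smul]
  rw [norm_sq_sum_smul c fun i hi j hj hij => by
    rw [hs.inner_apply (h i hi), hs.inner_eq_zero i j (h i hi) (h j hj) hij, mul_zero]]
  exact Finset.sum_congr rfl fun i hi => by rw [hs.norm_sq_apply (h i hi)]

/-- Only the closed span `K` of the singular vectors with `μ i ≤ ε ^ 2` matters here, as `T`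
vanishes on `x - P_K x`; on finite combinations from `K` the bound is Pythagoras. -/
theorem norm_apply_le (hs : SingularSystem T μ e) {ε : ℝ} (hε : 0 ≤ ε) {x : E}
    (hx : ∀ i, ε ^ 2 < μ i → inner 𝕜 (e i) x = 0) : ‖T x‖ ≤ ε * ‖x‖ := by
  let J := {i : ι // μ i ≠ 0 ∧ μ i ≤ ε ^ 2}
  let v : J → E := fun i => e i
  let K := (Submodule.span 𝕜 (Set.range v)).topologicalClosure
  have : CompleteSpace K :=
    (Submodule.isClosed_topologicalClosure _).isComplete.completeSpace_coe
  have hspan : ∀ y ∈ Submodule.span 𝕜 (Set.range v), ‖T y‖ ≤ ε * ‖y‖ := by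
    intro y hy
    obtain ⟨c, rfl⟩ := (Finsupp.mem_span_range_iff_exists_finsupp).1 hy
    have hinner : ∀ i ∈ c.support, ∀ j ∈ c.support, i ≠ j → inner 𝕜 (v i) (v j) = 0 :=
      fun i _ j _ hij => hs.inner_eq_zero _ _ i.2.1 j.2.1 fun h => hij (Subtype.ext h)
    have hinner' : ∀ i ∈ c.support, ∀ j ∈ c.support, i ≠ j →
        inner 𝕜 (T (v i)) (T (v j)) = 0 := fun i hi j hj hij => by
      rw [hs.inner_apply i.2.1, hinner i hi j hj hij, mul_zero]
    refine abs_le_of_sq_le_sq' ?_ (by positivity) |>.2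
    simp only [Finsupp.sum, map_sum, map_smul]
    rw [mul_pow, norm_sq_sum_smul _ hinner, norm_sq_sum_smul _ hinner', Finset.mul_sum]
    refine Finset.sum_le_sum fun i _ => ?_
    rw [hs.norm_sq_apply i.2.1, hs.norm_eq_one _ i.2.1]
    nlinarith [i.2.2, sq_nonneg ‖c i‖]
  have hK : ∀ y ∈ K, ‖T y‖ ≤ ε * ‖y‖ := by
    intro y hy
    have hcl : IsClosed {y : E | ‖T y‖ ≤ ε * ‖y‖} := isClosed_le (by fun_prop) (by fun_prop)
    exact hcl.closure_subset_iff.2 hspan hy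
  set p := K.starProjection x with hp
  have hpK : p ∈ K := K.starProjection_apply_mem x
  have hxp : x - p ∈ Kᗮ := K.sub_starProjection_mem_orthogonal x
  have hT : T (x - p) = 0 := by
    refine hs.complete _ fun i hi => ?_
    by_cases hiε : ε ^ 2 < μ i
    · have : p ∈ (Submodule.span 𝕜 {e i})ᗮ := by
        refine Submodule.topologicalClosure_minimal _ ?_ (Submodule.isClosed_orthogonal _) hpK
        rw [Submodule.span_le]
        rintro _ ⟨j, rfl⟩
        rw [SetLike.mem_coe, Submodule.mem_orthogonal_singleton_iff_inner_right]
        refine hs.inner_eq_zero _ _ hi j.2.1 ?_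
        rintro rfl
        exact absurd j.2.2 (not_le.2 hiε)
      rw [inner_sub_right, hx i hiε,
        Submodule.mem_orthogonal_singleton_iff_inner_right.1 this, sub_zero]
    · refine Submodule.inner_right_of_mem_orthogonal ?_ hxp
      exact Submodule.le_topologicalClosure _
        (Submodule.subset_span ⟨⟨i, hi, not_lt.1 hiε⟩, rfl⟩)
  have hTx : T x = T p := by rw [map_sub, sub_eq_zero] at hT; exact hT
  rw [hTx]
  refine (hK p hpK).trans (mul_le_mul_of_nonneg_left ?_ hε)
  exact K.norm_starProjection_apply_le x

theorem reindex (hs : SingularSystem T μ e) {κ : Type*} (g : κ ≃ ι) :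
    SingularSystem T (μ ∘ g) (e ∘ g) where
  nonneg i := hs.nonneg _
  norm_eq_one i := hs.norm_eq_one _
  inner_eq_zero i j hi hj hij := hs.inner_eq_zero _ _ hi hj (g.injective.ne hij)
  eigen i := hs.eigen _
  complete x hx := hs.complete x fun i hi => by
    have := hx (g.symm i)
    simpa [hi] using this

theorem adjoint_mem_closure (hs : SingularSystem T μ e) (y : F) :
    T.adjoint y ∈ (Submodule.span 𝕜 (e '' {i | μ i ≠ 0})).topologicalClosure := by
  rw [← Submodule.orthogonal_orthogonal_eq_closure, Submodule.mem_orthogonal]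
  intro x hx
  have : T x = 0 := hs.complete x fun i hi =>
    Submodule.inner_right_of_mem_orthogonal (Submodule.subset_span (Set.mem_image_of_mem e hi)) hx
  rw [ContinuousLinearMap.adjoint_inner_right, this, inner_zero_left]

end SingularSystem

/-! ### Tensor products of singular systems -/

section Tensor

variable {E' : Type*} [NormedAddCommGroup E'] [InnerProductSpace 𝕜 E'] [CompleteSpace E']
  {F' : Type*} [NormedAddCommGroup F'] [InnerProductSpace 𝕜 F'] [CompleteSpace F']
  {ι' : Type*}

theorem adjoint_completion_mapL (A : E →L[𝕜] F) (B : E' →L[𝕜] F') (y : F) (z : F') :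
    (TensorProduct.mapL A B).completion.adjoint
        ((y ⊗ₜ[𝕜] z : F ⊗[𝕜] F') : UniformSpace.Completion (F ⊗[𝕜] F')) =
      ((A.adjoint y ⊗ₜ[𝕜] B.adjoint z : E ⊗[𝕜] E') : UniformSpace.Completion (E ⊗[𝕜] E')) := by
  refine ext_inner_right 𝕜 fun x => ?_
  rw [ContinuousLinearMap.adjoint_inner_left]
  induction x using UniformSpace.Completion.induction_on with
  | hp => exact isClosed_eq (by fun_prop) (by fun_prop)
  | ih x =>
    rw [ContinuousLinearMap.completion_apply_coe, UniformSpace.Completion.inner_coe,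
      UniformSpace.Completion.inner_coe]
    induction x using TensorProduct.induction_on with
    | zero => simp
    | tmul a b =>
      rw [TensorProduct.mapL_tmul, TensorProduct.inner_tmul, TensorProduct.inner_tmul,
        ContinuousLinearMap.adjoint_inner_left, ContinuousLinearMap.adjoint_inner_left]
    | add a b ha hb => rw [map_add, inner_add_right, ha, hb, inner_add_right]

theorem apply_eq_zero_of_mem_closure {E : Type*} [NormedAddCommGroup E] [InnerProductSpace 𝕜 E]
    (φ : E →L[𝕜] 𝕜) {s : Set E} (h : ∀ x ∈ s, φ x = 0) :
    ∀ x ∈ (Submodule.span 𝕜 s).topologicalClosure, φ x = 0 := by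
  intro x hx
  have hle : (Submodule.span 𝕜 s).topologicalClosure ≤ LinearMap.ker φ.toLinearMap :=
    Submodule.topologicalClosure_minimal _ (Submodule.span_le.2 h) φ.isClosed_ker
  exact hle hx

/-- A bounded bilinear form that vanishes on `s × t` vanishes on the closed spans. -/
theorem apply_apply_eq_zero_of_mem_closure {E : Type*} [NormedAddCommGroup E]
    [InnerProductSpace 𝕜 E] {E' : Type*} [NormedAddCommGroup E'] [InnerProductSpace 𝕜 E']
    (β : E →L[𝕜] E' →L[𝕜] 𝕜) {s : Set E} {t : Set E'}
    (h : ∀ a ∈ s, ∀ b ∈ t, β a b = 0) :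
    ∀ a ∈ (Submodule.span 𝕜 s).topologicalClosure,
      ∀ b ∈ (Submodule.span 𝕜 t).topologicalClosure, β a b = 0 := by
  intro a ha b hb
  exact apply_eq_zero_of_mem_closure (β.flip b)
    (fun a ha => apply_eq_zero_of_mem_closure (β a) (h a ha) b hb) a ha

/-- The products of the singular vectors form a singular system of the tensor product operator.
For completeness, the adjoint maps elementary tensors to elementary tensors `A† y ⊗ B† z`, and these
lie in the closed span of the products `e i ⊗ f j`. -/
theorem SingularSystem.tensor {A : E →L[𝕜] F} {μ : ι → ℝ} {e : ι → E}
    (hA : SingularSystem A μ e) {B : E' →L[𝕜] F'} {ν : ι' → ℝ} {f : ι' → E'}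
    (hB : SingularSystem B ν f) :
    SingularSystem (TensorProduct.mapL A B).completion (fun i : ι × ι' => μ i.1 * ν i.2)
      (fun i => ((e i.1 ⊗ₜ[𝕜] f i.2 : E ⊗[𝕜] E') : UniformSpace.Completion (E ⊗[𝕜] E'))) where
  nonneg i := mul_nonneg (hA.nonneg _) (hB.nonneg _)
  norm_eq_one i hi := by
    rw [UniformSpace.Completion.norm_coe, TensorProduct.norm_tmul,
      hA.norm_eq_one _ (left_ne_zero_of_mul hi), hB.norm_eq_one _ (right_ne_zero_of_mul hi),
      one_mul]
  inner_eq_zero i j hi hj hij := by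
    rw [UniformSpace.Completion.inner_coe, TensorProduct.inner_tmul]
    by_cases h1 : i.1 = j.1
    · rw [hB.inner_eq_zero _ _ (right_ne_zero_of_mul hi) (right_ne_zero_of_mul hj)
        fun h2 => hij (Prod.ext h1 h2), mul_zero]
    · rw [hA.inner_eq_zero _ _ (left_ne_zero_of_mul hi) (left_ne_zero_of_mul hj) h1, zero_mul]
  eigen i hi := by
    rw [ContinuousLinearMap.completion_apply_coe, TensorProduct.mapL_tmul,
      adjoint_completion_mapL, hA.eigen _ (left_ne_zero_of_mul hi),
      hB.eigen _ (right_ne_zero_of_mul hi), TensorProduct.smul_tmul_smul,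
      UniformSpace.Completion.coe_smul]
    push_cast
    rfl
  complete x hx := by
    let β : E →L[𝕜] E' →L[𝕜] 𝕜 :=
      (ContinuousLinearMap.compL 𝕜 E' (E ⊗[𝕜] E') 𝕜 (innerSL 𝕜 x ∘L
        UniformSpace.Completion.toComplL)) ∘L TensorProduct.mkL 𝕜 E E'
    have hβ : ∀ a b, β a b =
        inner 𝕜 x ((a ⊗ₜ[𝕜] b : E ⊗[𝕜] E') : UniformSpace.Completion (E ⊗[𝕜] E')) :=
      fun _ _ => rfl
    have h2 := apply_apply_eq_zero_of_mem_closure β (s := e '' {i | μ i ≠ 0})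
      (t := f '' {j | ν j ≠ 0}) (by
        rintro _ ⟨i, hi, rfl⟩ _ ⟨j, hj, rfl⟩
        rw [hβ, inner_eq_zero_symm]
        exact hx (i, j) (mul_ne_zero hi hj))
    refine ext_inner_left 𝕜 fun w => ?_
    rw [inner_zero_right]
    induction w using UniformSpace.Completion.induction_on with
    | hp => exact isClosed_eq (by fun_prop) (by fun_prop)
    | ih w =>
      induction w using TensorProduct.induction_on with
      | zero => rw [UniformSpace.Completion.coe_zero, inner_zero_left]
      | tmul y z =>
        rw [← ContinuousLinearMap.adjoint_inner_left, adjoint_completion_mapL]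
        rw [inner_eq_zero_symm, ← hβ]
        exact h2 _ (hA.adjoint_mem_closure y) _ (hB.adjoint_mem_closure z)
      | add w w' h h' => rw [UniformSpace.Completion.coe_add, inner_add_left, h, h', add_zero]

end Tensor

end SingularSystem

theorem IsEigenSystem.singularSystem {𝕜 : Type*} [RCLike 𝕜]
    {E : Type*} [NormedAddCommGroup E] [InnerProductSpace 𝕜 E] [CompleteSpace E]
    {F : Type*} [NormedAddCommGroup F] [InnerProductSpace 𝕜 F] [CompleteSpace F]
    {T : E →L[𝕜] F} {lam : ℕ → ℝ} {η : ℕ → E} (h : IsEigenSystem (T.adjoint ∘L T) lam η) :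
    SingularSystem T lam η where
  nonneg := h.nonneg
  norm_eq_one i hi := h.orthonormal.1 ⟨i, hi⟩
  inner_eq_zero i j hi hj hij :=
    h.orthonormal.2 (i := ⟨i, hi⟩) (j := ⟨j, hj⟩) fun hh => hij (congrArg Subtype.val hh)
  eigen i _ := h.eigen i
  complete x hx := by
    have h0 : T.adjoint (T x) = 0 := h.complete x hx
    rw [← inner_self_eq_zero (𝕜 := 𝕜), ← ContinuousLinearMap.adjoint_inner_left, h0,
      inner_zero_left]

/-- The eigenvalues of the tensor product operator are the products of the eigenvalues of the
factors, indexed by multi-indices. -/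
theorem exists_singularSystem_tensorOp {𝕜 : Type u} [RCLike 𝕜]
    {X : ℕ → HilbSp.{u, v} 𝕜} {Y : ℕ → HilbSp.{u, w} 𝕜}
    (T : ∀ k, X k →L[𝕜] Y k) {lam : ℕ → ℕ → ℝ} {η : ∀ k, ℕ → X k}
    (h : ∀ k, SingularSystem (T k) (lam k) (η k)) (n : ℕ) :
    ∃ e : (Fin (n + 1) → ℕ) → tensorSpace X n,
      SingularSystem (tensorOp T n) (fun j => ∏ k : Fin (n + 1), lam k (j k)) e := by
  induction n with
  | zero =>
    have hμ : (fun j : Fin (0 + 1) → ℕ => ∏ k : Fin (0 + 1), lam k (j k)) =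
        lam 0 ∘ Equiv.funUnique (Fin 1) ℕ := by
      funext j
      simp
    rw [hμ]
    exact ⟨_, (h 0).reindex (Equiv.funUnique (Fin 1) ℕ)⟩
  | succ n ih =>
    obtain ⟨e, he⟩ := ih
    let g : (Fin (n + 2) → ℕ) ≃ (Fin (n + 1) → ℕ) × ℕ :=
      (Fin.snocEquiv (fun _ : Fin (n + 2) => ℕ)).symm.trans (Equiv.prodComm _ _)
    have hμ : (fun j : Fin (n + 2) → ℕ => ∏ k : Fin (n + 2), lam k (j k)) =
        (fun i : (Fin (n + 1) → ℕ) × ℕ => (∏ k : Fin (n + 1), lam k (i.1 k)) *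
          lam (n + 1) i.2) ∘ g := by
      funext j
      rw [Fin.prod_univ_castSucc]
      simp [g, Fin.snocEquiv, Fin.init]
    rw [hμ]
    exact ⟨_, (he.tensor (h (n + 1))).reindex g⟩

/-! ### Minimal errors and information complexity in terms of singular values -/

section InfoComplexity

variable {𝕜 : Type*} [RCLike 𝕜]
  {E : Type*} [NormedAddCommGroup E] [InnerProductSpace 𝕜 E] [CompleteSpace E]
  {F : Type*} [NormedAddCommGroup F] [InnerProductSpace 𝕜 F] [CompleteSpace F]
  {ι : Type*} {T : E →L[𝕜] F} {μ : ι → ℝ} {e : ι → E}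

/-- An algorithm that cannot distinguish `x` from `-x` has an error of at least `‖T x‖` at one of
these two points, by the triangle inequality `2 ‖T x‖ ≤ ‖T x - a‖ + ‖T (-x) - a‖`. -/
theorem ofReal_norm_le_worstCaseError {𝕜 : Type*} [RCLike 𝕜]
    {E : Type*} [NormedAddCommGroup E] [InnerProductSpace 𝕜 E]
    {F : Type*} [NormedAddCommGroup F] [InnerProductSpace 𝕜 F]
    (T : E →L[𝕜] F) (A : E → F) {x : E} (hx : ‖x‖ ≤ 1) (h : A x = A (-x)) :
    ENNReal.ofReal ‖T x‖ ≤ worstCaseError T A := by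
  have h1 : ‖T x - A x‖ₑ ≤ worstCaseError T A :=
    le_iSup₂ (f := fun (f : E) (_ : ‖f‖ ≤ 1) => ‖T f - A f‖ₑ) x hx
  have h2 : ‖T (-x) - A (-x)‖ₑ ≤ worstCaseError T A :=
    le_iSup₂ (f := fun (f : E) (_ : ‖f‖ ≤ 1) => ‖T f - A f‖ₑ) (-x) (by rwa [norm_neg])
  rw [← h, map_neg] at h2
  rw [← ofReal_norm] at h1 h2
  have h3 : ‖T x‖ ≤ ‖T x - A x‖ ∨ ‖T x‖ ≤ ‖-T x - A x‖ := by
    by_contra! hc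
    have : ‖T x + T x‖ ≤ ‖T x - A x‖ + ‖-T x - A x‖ := by
      calc ‖T x + T x‖ = ‖(T x - A x) - (-T x - A x)‖ := by congr 1; abel
        _ ≤ _ := norm_sub_le _ _
    rw [← two_smul 𝕜 (T x), norm_smul, RCLike.norm_ofNat] at this
    linarith [hc.1, hc.2]
  rcases h3 with h3 | h3
  · exact (ENNReal.ofReal_le_ofReal h3).trans h1
  · exact (ENNReal.ofReal_le_ofReal h3).trans h2

namespace SingularSystem

/-- The optimal algorithm is the truncated singular value decomposition. -/
theorem minError_card_le (hs : SingularSystem T μ e) {ε : ℝ} (hε : 0 ≤ ε) {s : Finset ι}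
    (hs0 : ∀ i ∈ s, μ i ≠ 0) (hsε : ∀ i, ε ^ 2 < μ i → i ∈ s) :
    minError T s.card ≤ ENNReal.ofReal ε := by
  have hmain : worstCaseError T (fun f => ∑ i ∈ s, (inner 𝕜 (e i) f : 𝕜) • T (e i)) ≤
      ENNReal.ofReal ε := by
    refine iSup₂_le fun f hf => ?_
    rw [← ofReal_norm]
    refine ENNReal.ofReal_le_ofReal ?_
    set p : E := ∑ i ∈ s, (inner 𝕜 (e i) f : 𝕜) • e i with hp
    have hin : ∀ i ∈ s, inner 𝕜 (e i) (f - p) = 0 := by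
      intro i hi
      rw [inner_sub_right, hp, inner_sum, Finset.sum_eq_single_of_mem i hi, inner_smul_right,
        inner_self_eq_norm_sq_to_K, hs.norm_eq_one i (hs0 i hi)]
      · simp
      · intro j hj hji
        rw [inner_smul_right, hs.inner_eq_zero i j (hs0 i hi) (hs0 j hj) hji.symm, mul_zero]
    have hpp : inner 𝕜 p (f - p) = 0 := by
      conv_lhs => rw [hp]
      rw [sum_inner]
      refine Finset.sum_eq_zero fun i hi => ?_
      rw [inner_smul_left, hin i hi, mul_zero]
    have hnorm : ‖f - p‖ ≤ 1 := by
      have h1 : ‖f‖ ^ 2 = ‖p‖ ^ 2 + ‖f - p‖ ^ 2 := by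
        have := norm_add_sq (𝕜 := 𝕜) p (f - p)
        rw [hpp, add_sub_cancel] at this
        simpa using this
      nlinarith [norm_nonneg (f - p), norm_nonneg f, sq_nonneg ‖p‖]
    have hTp : ∑ i ∈ s, (inner 𝕜 (e i) f : 𝕜) • T (e i) = T p := by
      simp [hp]
    beta_reduce
    rw [hTp, ← map_sub]
    calc ‖T (f - p)‖ ≤ ε * ‖f - p‖ := hs.norm_apply_le hε fun i hi => hin i (hsε i hi)
      _ ≤ ε := mul_le_of_le_one_right hε hnorm
  unfold minError
  split_ifs with h0
  · rw [Finset.card_eq_zero] at h0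
    subst h0
    simpa using hmain
  · let g := s.equivFin
    refine iInf₂_le_of_le (fun k => innerSL 𝕜 (e (g.symm k)))
      (fun y => ∑ k, y k • T (e (g.symm k))) (iInf_le_of_le ?_ ?_)
    · let _ : MeasurableSpace F := borel F
      have : BorelSpace F := ⟨rfl⟩
      exact Continuous.measurable (by fun_prop)
    · refine le_of_eq_of_le ?_ hmain
      congr 1
      funext f
      rw [← Finset.sum_coe_sort s, ← g.symm.sum_comp]
      rfl

/-- Any `n` linear functionals vanish at a common nonzero vector of the span of more than `n`
singular vectors. -/
theorem exists_norm_le_one_and_le_norm_apply (hs : SingularSystem T μ e) {n : ℕ} {s : Finset ι}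
    (hn : n < s.card) {m : ℝ} (hm : 0 < m) (hsm : ∀ i ∈ s, m ≤ μ i) (L : Fin n → E →L[𝕜] 𝕜) :
    ∃ x, ‖x‖ ≤ 1 ∧ (∀ i, L i x = 0) ∧ √m ≤ ‖T x‖ := by
  have hs0 : ∀ i ∈ s, μ i ≠ 0 := fun i hi => (hm.trans_le (hsm i hi)).ne'
  let Φ : (s → 𝕜) →ₗ[𝕜] (Fin n → 𝕜) :=
    (LinearMap.pi fun k => (L k).toLinearMap) ∘ₗ Fintype.linearCombination 𝕜 (fun i : s => e i)
  obtain ⟨c, hc, hc0⟩ := Submodule.exists_mem_ne_zero_of_ne_bot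
    (Φ.ker_ne_bot_of_finrank_lt (by simpa using hn))
  classical
  let c' : ι → 𝕜 := fun i => if h : i ∈ s then c ⟨i, h⟩ else 0
  set y : E := ∑ i ∈ s, c' i • e i with hy
  have hLy : ∀ k, L k y = 0 := by
    intro k
    have hk : Φ c k = 0 := by
      rw [LinearMap.mem_ker.1 hc]
      rfl
    have hyc : Fintype.linearCombination 𝕜 (fun i : s => e i) c = y := by
      rw [hy, Fintype.linearCombination_apply, ← Finset.sum_coe_sort s]
      refine Finset.sum_congr rfl fun i _ => ?_
      simp [c']
    rw [← hyc]
    exact hk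
  have hy0 : 0 < ‖y‖ ^ 2 := by
    rw [hs.norm_sq_sum hs0]
    obtain ⟨i, hi⟩ := Function.ne_iff.1 hc0
    refine Finset.sum_pos' (fun _ _ => by positivity) ⟨i, i.2, ?_⟩
    have : c' i ≠ 0 := by simpa [c'] using hi
    positivity
  have hy1 : 0 < ‖y‖ := by
    rcases (norm_nonneg y).eq_or_lt with h | h
    · rw [← h] at hy0
      norm_num at hy0
    · exact h
  have hTy : √m * ‖y‖ ≤ ‖T y‖ := by
    refine abs_le_of_sq_le_sq' ?_ (norm_nonneg _) |>.2
    rw [mul_pow, Real.sq_sqrt hm.le, hs.norm_sq_sum hs0, hs.norm_sq_apply_sum hs0, Finset.mul_sum]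
    refine Finset.sum_le_sum fun i hi => ?_
    rw [mul_comm]
    exact mul_le_mul_of_nonneg_left (hsm i hi) (by positivity)
  refine ⟨((‖y‖⁻¹ : ℝ) : 𝕜) • y, ?_, fun k => ?_, ?_⟩
  · rw [norm_smul, RCLike.norm_ofReal, abs_of_pos (inv_pos.2 hy1), inv_mul_cancel₀ hy1.ne']
  · rw [map_smul, hLy, smul_zero]
  · rw [map_smul, norm_smul, RCLike.norm_ofReal, abs_of_pos (inv_pos.2 hy1), ← div_eq_inv_mul,
      le_div_iff₀ hy1]
    exact hTy

theorem lt_minError (hs : SingularSystem T μ e) {ε : ℝ} {n : ℕ} {s : Finset ι}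
    (hn : n < s.card) (hsε : ∀ i ∈ s, ε ^ 2 < μ i) :
    ENNReal.ofReal ε < minError T n := by
  have hne : s.Nonempty := Finset.card_pos.1 (by omega)
  obtain ⟨i₀, hi₀, hmin⟩ := s.exists_min_image μ hne
  have hm : 0 < μ i₀ := (sq_nonneg ε).trans_lt (hsε i₀ hi₀)
  have hlt : ENNReal.ofReal ε < ENNReal.ofReal √(μ i₀) :=
    (ENNReal.ofReal_lt_ofReal_iff (Real.sqrt_pos.2 hm)).2 (Real.lt_sqrt_of_sq_lt (hsε i₀ hi₀))
  refine hlt.trans_le ?_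
  have key := hs.exists_norm_le_one_and_le_norm_apply hn hm hmin
  unfold minError
  split_ifs with h0
  · subst h0
    obtain ⟨x, hx, -, hTx⟩ := key fun k => k.elim0
    exact (ENNReal.ofReal_le_ofReal hTx).trans (ofReal_norm_le_worstCaseError T _ hx rfl)
  · refine le_iInf₂ fun L φ => le_iInf fun _ => ?_
    obtain ⟨x, hx, hL, hTx⟩ := key L
    refine (ENNReal.ofReal_le_ofReal hTx).trans (ofReal_norm_le_worstCaseError T _ hx ?_)
    simp [hL]

/-- The information complexity counts the eigenvalues of `T† T` above the squared threshold. -/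
theorem infoComplexity_eq_ncard (hs : SingularSystem T μ e) {ε : ℝ} (hε : 0 ≤ ε)
    (hfin : {i | ε ^ 2 < μ i}.Finite) {c : Criterion} (hcri : cri c T = 1) :
    infoComplexity c T ε = {i | ε ^ 2 < μ i}.ncard := by
  rw [Set.ncard_eq_toFinset_card _ hfin]
  set s := hfin.toFinset
  have hmem : ∀ i, i ∈ s ↔ ε ^ 2 < μ i := fun i => hfin.mem_toFinset
  unfold infoComplexity
  rw [hcri, mul_one]
  have hcard : minError T s.card ≤ ENNReal.ofReal ε :=
    hs.minError_card_le hε (fun i hi => ((sq_nonneg ε).trans_lt ((hmem i).1 hi)).ne')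
      fun i hi => (hmem i).2 hi
  refine le_antisymm (Nat.sInf_le hcard) (le_csInf ⟨_, hcard⟩ fun n hn => ?_)
  by_contra! hlt
  exact absurd (hs.lt_minError hlt fun i hi => (hmem i).1 hi) (not_lt.2 hn)

/-- If the largest eigenvalue is `1`, then the absolute and normalized criterion agree. -/
theorem cri_eq_one (hs : SingularSystem T μ e) (hle : ∀ i, μ i ≤ 1) {i₀ : ι} (h₀ : μ i₀ = 1)
    (c : Criterion) : cri c T = 1 := by
  cases c with
  | ABS => rfl
  | NOR =>
    change minError T 0 = 1
    refine le_antisymm ?_ ?_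
    · have := hs.minError_card_le zero_le_one (s := ∅) (by simp)
        fun i hi => absurd (hle i) (not_le.2 (by simpa using hi))
      simpa using this
    · have h1 : ‖T (e i₀)‖ = 1 := by
        have := hs.norm_sq_apply (i := i₀) (by rw [h₀]; exact one_ne_zero)
        rw [h₀] at this
        exact (pow_eq_one_iff_of_nonneg (norm_nonneg _) two_ne_zero).1 this
      have := ofReal_norm_le_worstCaseError T (fun _ => 0) (x := e i₀)
        (hs.norm_eq_one i₀ (by rw [h₀]; exact one_ne_zero)).le rfl
      rw [h1, ENNReal.ofReal_one] at this
      unfold minError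
      simpa using this

end SingularSystem

end InfoComplexity

/-! ### Counting products of eigenvalues -/

section Counting

/-- The number of multi-indices `j ∈ ℕ^d` whose eigenvalue `∏ lam k (j k)` exceeds `ε ^ 2`
(`0` if there are infinitely many). -/
noncomputable def spectralCount (lam : ℕ → ℕ → ℝ) (ε : ℝ) (d : ℕ) : ℕ :=
  {j : Fin d → ℕ | ε ^ 2 < ∏ k : Fin d, lam k (j k)}.ncard

/-- The normalized `τ`-power sums of all rows are bounded by `M`; stated for partial sums, in
order to stay within the reals. -/
def RowBound (lam : ℕ → ℕ → ℝ) (τ M : ℝ) : Prop :=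
  ∀ k n : ℕ, ∑ j ∈ Finset.range n, (lam k (j + 1) / lam k 1) ^ τ ≤ M

variable {lam : ℕ → ℕ → ℝ}

namespace PropertyP

theorem hRatio_eq (hP : PropertyP lam) (k : ℕ) : hRatio lam k = lam k 1 := by
  rw [hRatio, hP.first_eq_one, div_one]

theorem le_one (hP : PropertyP lam) (ha : ∀ k, Antitone (lam k)) (k j : ℕ) : lam k j ≤ 1 :=
  (ha k (Nat.zero_le j)).trans (hP.first_eq_one k).le

/-- As the quotients are at most `1`, a bound for one exponent holds for all larger ones. -/
theorem rowBound (hP : PropertyP lam) (h0 : ∀ k j, 0 ≤ lam k j) (ha : ∀ k, Antitone (lam k))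
    {τ' τ : ℝ} (hτ' : 0 ≤ τ') (hdom : DominatedByFirst lam τ') (hτ : τ' ≤ τ) :
    RowBound lam τ (HSum lam 0 τ').toReal := by
  intro k n
  have hpos : 0 < lam k 1 := hP.hRatio_eq k ▸ (hP.ratio_mem k).1
  have hterm : ∀ j, 0 ≤ lam k (j + 1) / lam k 1 := fun j => div_nonneg (h0 _ _) hpos.le
  calc ∑ j ∈ Finset.range n, (lam k (j + 1) / lam k 1) ^ τ
      ≤ ∑ j ∈ Finset.range n, (lam k (j + 1) / lam k 1) ^ τ' :=
        Finset.sum_le_sum fun j _ => Real.rpow_le_rpow_of_exponent_ge' (hterm j)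
          ((div_le_one hpos).2 (ha k (by omega))) hτ' hτ
    _ ≤ (HSum lam 0 τ').toReal := by
        rw [← ENNReal.ofReal_le_iff_le_toReal hdom.2.ne, ENNReal.ofReal_sum_of_nonneg
          fun j _ => Real.rpow_nonneg (hterm j) _]
        calc _ ≤ HSum lam k τ' := ENNReal.sum_le_tsum _
          _ ≤ ⨆ k, HSum lam k τ' := le_iSup (fun k => HSum lam k τ') k
          _ = HSum lam 0 τ' := hdom.1

end PropertyP

theorem RowBound.sum_rpow_le (hP : PropertyP lam) (h0 : ∀ k j, 0 ≤ lam k j) {τ M : ℝ}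
    (hM : RowBound lam τ M) (k n : ℕ) :
    ∑ j ∈ Finset.range n, lam k j ^ τ ≤ 1 + M * hRatio lam k ^ τ := by
  have hpos : 0 < lam k 1 := hP.hRatio_eq k ▸ (hP.ratio_mem k).1
  have h1 : ∀ j, lam k (j + 1) ^ τ = (lam k (j + 1) / lam k 1) ^ τ * lam k 1 ^ τ := fun j => by
    rw [← Real.mul_rpow (div_nonneg (h0 _ _) hpos.le) hpos.le, div_mul_cancel₀ _ hpos.ne']
  calc ∑ j ∈ Finset.range n, lam k j ^ τ ≤ ∑ j ∈ Finset.range (n + 1), lam k j ^ τ :=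
        Finset.sum_le_sum_of_subset_of_nonneg (Finset.range_mono n.le_succ)
          fun j _ _ => Real.rpow_nonneg (h0 _ _) _
    _ = 1 + (∑ j ∈ Finset.range n, (lam k (j + 1) / lam k 1) ^ τ) * lam k 1 ^ τ := by
        rw [Finset.sum_range_succ', hP.first_eq_one, Real.one_rpow, add_comm, Finset.sum_mul]
        exact congrArg _ (Finset.sum_congr rfl fun j _ => h1 j)
    _ ≤ 1 + M * hRatio lam k ^ τ := by
        rw [hP.hRatio_eq]
        gcongr
        exact hM k n

variable {ε : ℝ} {d : ℕ}

/-- Every multi-index that is counted lies in a fixed cube. -/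
theorem exists_subset_piFinset_range (hP : PropertyP lam) (h0 : ∀ k j, 0 ≤ lam k j)
    (ha : ∀ k, Antitone (lam k)) {τ M : ℝ} (hτ : 0 < τ) (hM : RowBound lam τ M)
    (hε : 0 < ε) (d : ℕ) :
    ∃ n : ℕ, {j : Fin d → ℕ | ε ^ 2 < ∏ k : Fin d, lam k (j k)} ⊆
      (Fintype.piFinset fun _ : Fin d => Finset.range n : Finset (Fin d → ℕ)) := by
  have hc : 0 < (ε ^ 2) ^ τ := by positivity
  have hM0 : 0 ≤ M := by simpa using hM 0 0
  refine ⟨⌈(1 + M) / (ε ^ 2) ^ τ⌉₊, fun j hj => ?_⟩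
  simp only [Finset.mem_coe, Fintype.mem_piFinset, Finset.mem_range]
  intro k
  have hk : ε ^ 2 < lam k (j k) := by
    refine lt_of_lt_of_le hj ?_
    rw [← Finset.mul_prod_erase _ _ (Finset.mem_univ k)]
    exact mul_le_of_le_one_right (h0 _ _)
      (Finset.prod_le_one (fun _ _ => h0 _ _) fun _ _ => hP.le_one ha _ _)
  have h1 : ((j k + 1 : ℕ) : ℝ) * (ε ^ 2) ^ τ ≤ 1 + M := by
    calc ((j k + 1 : ℕ) : ℝ) * (ε ^ 2) ^ τ = ∑ _i ∈ Finset.range (j k + 1), (ε ^ 2) ^ τ := by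
          simp
      _ ≤ ∑ i ∈ Finset.range (j k + 1), lam k i ^ τ := by
          refine Finset.sum_le_sum fun i hi => ?_
          refine Real.rpow_le_rpow (by positivity) (hk.le.trans (ha k ?_)) hτ.le
          have := Finset.mem_range.1 hi
          omega
      _ ≤ 1 + M * hRatio lam k ^ τ := hM.sum_rpow_le hP h0 k _
      _ ≤ 1 + M := by
          gcongr
          exact mul_le_of_le_one_right hM0
            (Real.rpow_le_one (hP.ratio_mem k).1.le (hP.ratio_mem k).2 hτ.le)
  have h2 : ((j k + 1 : ℕ) : ℝ) ≤ (⌈(1 + M) / (ε ^ 2) ^ τ⌉₊ : ℝ) :=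
    ((le_div_iff₀ hc).2 h1).trans (Nat.le_ceil _)
  have : j k + 1 ≤ ⌈(1 + M) / (ε ^ 2) ^ τ⌉₊ := by exact_mod_cast h2
  omega

theorem finite_setOf_lt_prod (hP : PropertyP lam) (h0 : ∀ k j, 0 ≤ lam k j)
    (ha : ∀ k, Antitone (lam k)) (hε : 0 < ε) (d : ℕ) :
    {j : Fin d → ℕ | ε ^ 2 < ∏ k : Fin d, lam k (j k)}.Finite := by
  obtain ⟨τ, hτ, hdom⟩ := hP.dominated
  obtain ⟨n, hn⟩ :=
    exists_subset_piFinset_range hP h0 ha hτ (hP.rowBound h0 ha hτ.le hdom le_rfl) hε d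
  exact (Finset.finite_toSet _).subset hn

/-- Markov's inequality for the `τ`-power sum of all eigenvalues, which is a product over the
factors. -/
theorem spectralCount_le (hP : PropertyP lam) (h0 : ∀ k j, 0 ≤ lam k j)
    (ha : ∀ k, Antitone (lam k)) {τ M : ℝ} (hτ : 0 < τ) (hM : RowBound lam τ M)
    (hε : 0 < ε) (d : ℕ) :
    (spectralCount lam ε d : ℝ) ≤
      ε⁻¹ ^ (2 * τ) * ∏ k ∈ Finset.range d, (1 + M * hRatio lam k ^ τ) := by
  obtain ⟨n, hn⟩ := exists_subset_piFinset_range hP h0 ha hτ hM hε d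
  have hfin := finite_setOf_lt_prod hP h0 ha hε d
  have hc : 0 < (ε ^ 2) ^ τ := by positivity
  have hinv : ε⁻¹ ^ (2 * τ) = ((ε ^ 2) ^ τ)⁻¹ := by
    rw [Real.inv_rpow hε.le, Real.rpow_mul hε.le, Real.rpow_two]
  rw [hinv, ← div_eq_inv_mul, le_div_iff₀ hc, spectralCount, Set.ncard_eq_toFinset_card _ hfin]
  calc (hfin.toFinset.card : ℝ) * (ε ^ 2) ^ τ
      = ∑ _j ∈ hfin.toFinset, (ε ^ 2) ^ τ := by simp
    _ ≤ ∑ j ∈ hfin.toFinset, ∏ k : Fin d, lam k (j k) ^ τ := by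
        refine Finset.sum_le_sum fun j hj => ?_
        rw [Real.finsetProd_rpow _ _ fun k _ => h0 _ _]
        exact Real.rpow_le_rpow (by positivity) (hfin.mem_toFinset.1 hj).le hτ.le
    _ ≤ ∑ j ∈ Fintype.piFinset fun _ : Fin d => Finset.range n,
          ∏ k : Fin d, lam k (j k) ^ τ := by
        refine Finset.sum_le_sum_of_subset_of_nonneg (fun j hj => ?_)
          fun j _ _ => Finset.prod_nonneg fun k _ => Real.rpow_nonneg (h0 _ _) _
        exact hn (hfin.mem_toFinset.1 hj)
    _ = ∏ k : Fin d, ∑ i ∈ Finset.range n, lam k i ^ τ :=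
        (Finset.prod_univ_sum (fun _ : Fin d => Finset.range n)
          fun k i => lam k i ^ τ).symm
    _ ≤ ∏ k : Fin d, (1 + M * hRatio lam k ^ τ) :=
        Finset.prod_le_prod
          (fun k _ => Finset.sum_nonneg fun i _ => Real.rpow_nonneg (h0 _ _) _)
          fun k _ => hM.sum_rpow_le hP h0 k n
    _ = ∏ k ∈ Finset.range d, (1 + M * hRatio lam k ^ τ) :=
        Fin.prod_univ_eq_prod_range (fun k => 1 + M * hRatio lam k ^ τ) d

/-- Multi-indices with entries in `{0, 1}` correspond to sets of coordinates. -/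
theorem card_le_spectralCount (hP : PropertyP lam) (h0 : ∀ k j, 0 ≤ lam k j)
    (ha : ∀ k, Antitone (lam k)) (hε : 0 < ε) {𝒜 : Finset (Finset (Fin d))}
    (h𝒜 : ∀ A ∈ 𝒜, ε ^ 2 < ∏ k ∈ A, hRatio lam (k : ℕ)) :
    𝒜.card ≤ spectralCount lam ε d := by
  have hfin := finite_setOf_lt_prod hP h0 ha hε d
  rw [spectralCount, Set.ncard_eq_toFinset_card _ hfin]
  refine Finset.card_le_card_of_injOn (fun A k => if k ∈ A then 1 else 0) (fun A hA => ?_) ?_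
  · rw [Finset.mem_coe, hfin.mem_toFinset, Set.mem_ofPred_eq]
    refine (h𝒜 A hA).trans_eq ?_
    rw [← Finset.prod_subset (Finset.subset_univ A)]
    · refine Finset.prod_congr rfl fun k hk => ?_
      simp only [if_pos hk, hP.hRatio_eq]
    · intro k _ hk
      simp only [if_neg hk, hP.first_eq_one]
  · intro A _ B _ hAB
    ext k
    have := congrFun hAB k
    by_cases hA : k ∈ A <;> by_cases hB : k ∈ B <;> simp_all

end Counting

/-! ### Two-sided bounds for the information complexity -/

/-- The bounds on an information complexity `N` from which tractability is decided: a Markov bound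
from above for all large exponents `τ`, and from below the numbers of eigenvalues obtained from
`m` second eigenvalues, from the first factor alone, or from all factors if `h ≡ 1`. -/
structure ComplexityBounds (lam : ℕ → ℕ → ℝ) (N : ℝ → ℕ → ℕ) : Prop where
  le : ∀ τ', 0 < τ' → DominatedByFirst lam τ' → ∃ M : ℝ, 0 ≤ M ∧ ∀ τ, τ' ≤ τ →
    ∀ d : ℕ, 1 ≤ d → ∀ ε : ℝ, 0 < ε → ε < 1 → (N ε d : ℝ) ≤
      ε⁻¹ ^ (2 * τ) * ∏ k ∈ Finset.range d, (1 + M * hRatio lam k ^ τ)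
  choose_le : ∀ d : ℕ, 1 ≤ d → ∀ ε : ℝ, 0 < ε → ε < 1 → ∀ m : ℕ,
    ε ^ 2 < hRatio lam (d - 1) ^ m → d.choose m ≤ N ε d
  succ_le : ∀ ε : ℝ, 0 < ε → ε < 1 → ∀ j : ℕ, ε ^ 2 < lam 0 j → j + 1 ≤ N ε 1
  two_pow_le : (∀ k, hRatio lam k = 1) → ∀ d : ℕ, 1 ≤ d → ∀ ε : ℝ, 0 < ε → ε < 1 → 2 ^ d ≤ N ε d

theorem TensorProductProblem.complexity_eq_spectralCount {𝕜 : Type u} [RCLike 𝕜]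
    (P : TensorProductProblem.{u, v, w} 𝕜) {lam : ℕ → ℕ → ℝ} {η : ∀ k, ℕ → P.H k}
    (hlam : ∀ k, IsEigenSystem (P.W k) (lam k) (η k)) (hP : PropertyP lam) (c : Criterion)
    {ε : ℝ} (hε : 0 < ε) {d : ℕ} (hd : 1 ≤ d) :
    P.complexity c ε d = spectralCount lam ε d := by
  obtain ⟨n, rfl⟩ := Nat.exists_eq_add_of_le' hd
  have h0 : ∀ k j, 0 ≤ lam k j := fun k => (hlam k).nonneg
  have ha : ∀ k, Antitone (lam k) := fun k => (hlam k).antitone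
  obtain ⟨e, he⟩ := exists_singularSystem_tensorOp P.S (fun k => (hlam k).singularSystem) n
  refine he.infoComplexity_eq_ncard hε.le (finite_setOf_lt_prod hP h0 ha hε (n + 1)) ?_
  refine he.cri_eq_one (fun j => Finset.prod_le_one (fun _ _ => h0 _ _)
    fun _ _ => hP.le_one ha _ _) (i₀ := fun _ => 0) ?_ c
  simp [hP.first_eq_one]

theorem TensorProductProblem.complexityBounds {𝕜 : Type u} [RCLike 𝕜]
    (P : TensorProductProblem.{u, v, w} 𝕜) {lam : ℕ → ℕ → ℝ} {η : ∀ k, ℕ → P.H k}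
    (hlam : ∀ k, IsEigenSystem (P.W k) (lam k) (η k)) (hP : PropertyP lam) (c : Criterion) :
    ComplexityBounds lam (P.complexity c) := by
  have h0 : ∀ k j, 0 ≤ lam k j := fun k => (hlam k).nonneg
  have ha : ∀ k, Antitone (lam k) := fun k => (hlam k).antitone
  refine ⟨fun τ' hτ' hdom => ⟨(HSum lam 0 τ').toReal, ENNReal.toReal_nonneg,
    fun τ hτ d hd ε hε _ => ?_⟩, fun d hd ε hε _ m hm => ?_, fun ε hε _ j hj => ?_,
    fun h1 d hd ε hε hε1 => ?_⟩
  · rw [P.complexity_eq_spectralCount hlam hP c hε hd]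
    exact spectralCount_le hP h0 ha (hτ'.trans_le hτ) (hP.rowBound h0 ha hτ'.le hdom hτ) hε d
  · rw [P.complexity_eq_spectralCount hlam hP c hε hd]
    have := card_le_spectralCount hP h0 ha hε (d := d)
      (𝒜 := Finset.powersetCard m Finset.univ) fun A hA => by
        refine hm.trans_le ?_
        rw [← (Finset.mem_powersetCard.1 hA).2, ← Finset.prod_const]
        refine Finset.prod_le_prod (fun _ _ => (hP.ratio_mem _).1.le)
          fun k _ => hP.ratio_antitone ?_
        have := k.2
        omega
    simpa using this
  · rw [P.complexity_eq_spectralCount hlam hP c hε le_rfl, spectralCount,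
      Set.ncard_eq_toFinset_card _ (finite_setOf_lt_prod hP h0 ha hε 1),
      ← Finset.card_range (j + 1)]
    refine Finset.card_le_card_of_injOn (fun i _ => i) (fun i hi => ?_) fun a _ b _ hab =>
      congrFun hab 0
    rw [Finset.mem_coe, Set.Finite.mem_toFinset, Set.mem_ofPred_eq]
    refine hj.trans_le ?_
    have hi' := Finset.mem_range.1 hi
    simpa using ha 0 (by omega : i ≤ j)
  · rw [P.complexity_eq_spectralCount hlam hP c hε hd]
    have := card_le_spectralCount hP h0 ha hε (d := d) (𝒜 := Finset.univ.powerset) fun A _ => by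
      simp only [h1, Finset.prod_const_one]
      nlinarith
    simpa using this

/-! ### Elementary facts on `h`, `A_*` and `B` -/

section Ratio

variable {lam : ℕ → ℕ → ℝ}

namespace PropertyP

theorem log_inv_nonneg (hP : PropertyP lam) (k : ℕ) : 0 ≤ Real.log (hRatio lam k)⁻¹ :=
  Real.log_nonneg ((one_le_inv₀ (hP.ratio_mem k).1).2 (hP.ratio_mem k).2)

theorem log_inv_mono (hP : PropertyP lam) : Monotone fun k => Real.log (hRatio lam k)⁻¹ :=
  fun _ b hab => Real.log_le_log (inv_pos.2 (hP.ratio_mem _).1)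
    (inv_anti₀ (hP.ratio_mem b).1 (hP.ratio_antitone hab))

theorem rpow_eq_exp (hP : PropertyP lam) (k : ℕ) (τ : ℝ) :
    hRatio lam k ^ τ = Real.exp (-(Real.log (hRatio lam k)⁻¹ * τ)) := by
  rw [Real.rpow_def_of_pos (hP.ratio_mem k).1, Real.log_inv]
  congr 1
  ring

theorem pow_eq_exp (hP : PropertyP lam) (k m : ℕ) :
    hRatio lam k ^ m = Real.exp (-(Real.log (hRatio lam k)⁻¹ * m)) := by
  rw [← Real.rpow_natCast, hP.rpow_eq_exp]

theorem rpow_le_one (hP : PropertyP lam) (k : ℕ) {τ : ℝ} (hτ : 0 ≤ τ) : hRatio lam k ^ τ ≤ 1 :=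
  Real.rpow_le_one (hP.ratio_mem k).1.le (hP.ratio_mem k).2 hτ

theorem exists_tendsto_log_inv (hP : PropertyP lam) :
    ∃ B : EReal,
      Tendsto (fun k : ℕ => ((Real.log (hRatio lam k)⁻¹ : ℝ) : EReal)) atTop (𝓝 B) ∧
      (0 < B ↔ ¬ ∀ k, hRatio lam k = 1) := by
  refine ⟨_, tendsto_atTop_iSup fun a b hab => EReal.coe_le_coe_iff.2 (hP.log_inv_mono hab), ?_⟩
  rw [lt_iSup_iff, not_forall]
  refine exists_congr fun k => ?_
  rw [EReal.coe_pos]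
  have h1 := hP.ratio_mem k
  constructor
  · rintro h hk
    rw [hk] at h
    simp at h
  · intro h
    exact Real.log_pos ((one_lt_inv₀ h1.1).2 (lt_of_le_of_ne h1.2 h))

end PropertyP

theorem eventually_const_lt_mul_log {a : ℝ} (ha : 0 < a) (c : ℝ) :
    ∀ᶠ d : ℕ in atTop, c < a * Real.log d :=
  ((Real.tendsto_log_atTop.comp tendsto_natCast_atTop_atTop).const_mul_atTop
    ha).eventually_gt_atTop c

theorem le_of_eventually_mul_log_le {a b c : ℝ}
    (h : ∀ᶠ d : ℕ in atTop, a * Real.log d - c ≤ b * Real.log d) : a ≤ b := by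
  by_contra! hab
  obtain ⟨d, h1, h2⟩ := (h.and (eventually_const_lt_mul_log (sub_pos.2 hab) c)).exists
  linarith

theorem le_AStar {κ c : ℝ}
    (h : ∀ᶠ d : ℕ in atTop, κ * Real.log d - c ≤ Real.log (hRatio lam (d - 1))⁻¹) :
    (κ : EReal) ≤ AStar lam := by
  refine EReal.ge_of_forall_gt_iff_ge.1 fun z hz => ?_
  have hz' : z < κ := by exact_mod_cast hz
  refine le_liminf_of_le (h := ?_)
  filter_upwards [h, eventually_const_lt_mul_log (sub_pos.2 hz') c,
    eventually_const_lt_mul_log one_pos 0] with d h1 h2 h3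
  rw [EReal.coe_le_coe_iff, le_div_iff₀ (by simpa using h3)]
  linarith

theorem eventually_mul_log_le_of_lt_AStar {a : ℝ} (h : (a : EReal) < AStar lam) :
    ∀ᶠ d : ℕ in atTop, a * Real.log d ≤ Real.log (hRatio lam (d - 1))⁻¹ := by
  filter_upwards [eventually_lt_of_lt_liminf h, eventually_const_lt_mul_log one_pos 0]
    with d h1 h2
  rw [EReal.coe_lt_coe_iff, lt_div_iff₀ (by simpa using h2)] at h1
  exact h1.le

theorem eventually_mul_log_le_log_choose (m : ℕ) :
    ∃ c : ℝ, ∀ᶠ d : ℕ in atTop, m * Real.log d - c ≤ Real.log (d.choose m) := by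
  refine ⟨m * Real.log 2 + Real.log m.factorial, ?_⟩
  filter_upwards [eventually_ge_atTop (2 * m), eventually_gt_atTop 0] with d hd hd0
  have h1 := Nat.pow_le_choose (α := ℝ) m d
  have hd0' : (0 : ℝ) < d := by exact_mod_cast hd0
  have h2 : (d : ℝ) / 2 ≤ ((d + 1 - m : ℕ) : ℝ) := by
    have : (d : ℝ) ≤ ((2 * (d + 1 - m) : ℕ) : ℝ) := by exact_mod_cast (by omega)
    push_cast at this ⊢
    linarith
  have h3 : ((d : ℝ) / 2) ^ m / m.factorial ≤ d.choose m :=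
    (div_le_div_of_nonneg_right (pow_le_pow_left₀ (by positivity) h2 m) (by positivity)).trans h1
  have h4 := Real.log_le_log (by positivity) h3
  rw [Real.log_div (by positivity) (by positivity), Real.log_pow,
    Real.log_div (by positivity) (by positivity)] at h4
  linarith

/-- The two exponents of tractability arise in the same way from a set `S` of admissible
exponents. -/
theorem sInf_bounds {S : Set ℝ} {A : EReal} {τ₀ τ₁ : ℝ} (hA : 0 < A) (h0 : 0 ≤ τ₀)
    (hne : S.Nonempty) (hτ : ∀ p ∈ S, 2 * τ₁ ≤ p) (hp : ∀ p ∈ S, 0 < p)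
    (hpA : ∀ p ∈ S, ((2 / p : ℝ) : EReal) ≤ A)
    (hup : ∀ x : ℝ, 2 * τ₀ < x → ((2 / x : ℝ) : EReal) < A → x ∈ S) :
    max (2 / A) ((2 * τ₁ : ℝ) : EReal) ≤ ((sInf S : ℝ) : EReal) ∧
      ((sInf S : ℝ) : EReal) ≤ max (2 / A) ((2 * τ₀ : ℝ) : EReal) ∧
      (τ₀ = τ₁ → ((sInf S : ℝ) : EReal) = max (2 / A) ((2 * τ₀ : ℝ) : EReal)) := by
  obtain ⟨r, hr, hr1, hr2⟩ : ∃ r : ℝ, 2 / A = (r : EReal) ∧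
      (∀ x : ℝ, 0 < x → ((2 / x : ℝ) : EReal) ≤ A → r ≤ x) ∧
      (∀ x : ℝ, 0 < x → r < x → ((2 / x : ℝ) : EReal) < A) := by
    induction A using EReal.rec with
    | bot => simp at hA
    | top => exact ⟨0, by simp, fun x hx _ => hx.le, fun x _ _ => EReal.coe_lt_top _⟩
    | coe a =>
      have ha : 0 < a := by exact_mod_cast hA
      refine ⟨2 / a, by rw [EReal.coe_div]; rfl, fun x hx h => ?_, fun x hx h => ?_⟩
      · rw [EReal.coe_le_coe_iff, div_le_iff₀ hx] at h
        rwa [div_le_iff₀' ha]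
      · rw [div_lt_iff₀' ha] at h
        rwa [EReal.coe_lt_coe_iff, div_lt_iff₀ hx]
  have hbdd : BddBelow S := ⟨0, fun p h => (hp p h).le⟩
  have hlow : max (2 / A) ((2 * τ₁ : ℝ) : EReal) ≤ ((sInf S : ℝ) : EReal) := by
    rw [hr]
    refine max_le (EReal.coe_le_coe_iff.2 (le_csInf hne fun p h => hr1 p (hp p h) (hpA p h)))
      (EReal.coe_le_coe_iff.2 (le_csInf hne hτ))
  have hupp : ((sInf S : ℝ) : EReal) ≤ max (2 / A) ((2 * τ₀ : ℝ) : EReal) := by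
    refine EReal.le_of_forall_lt_iff_le.1 fun x hx => ?_
    rw [hr, max_lt_iff, EReal.coe_lt_coe_iff, EReal.coe_lt_coe_iff] at hx
    rw [EReal.coe_le_coe_iff]
    exact csInf_le hbdd (hup x hx.2 (hr2 x (by linarith [hx.2]) hx.1))
  exact ⟨hlow, hupp, fun h => le_antisymm hupp (h ▸ hlow)⟩

theorem tauZero_nonneg (lam : ℕ → ℕ → ℝ) : 0 ≤ tauZero lam :=
  Real.sInf_nonneg fun _ h => h.1.le

theorem exists_dominated_lt (hP : PropertyP lam) {x : ℝ} (hx : tauZero lam < x) :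
    ∃ τ, 0 < τ ∧ DominatedByFirst lam τ ∧ τ < x := by
  obtain ⟨τ, h, hτ⟩ := exists_lt_of_csInf_lt hP.dominated hx
  exact ⟨τ, h.1, h.2, hτ⟩

end Ratio

/-! ### Strong polynomial and polynomial tractability -/

section Polynomial

variable {lam : ℕ → ℕ → ℝ} {N : ℝ → ℕ → ℕ}

theorem prod_one_add_le_exp {M : ℝ} (hM : 0 ≤ M) {f : ℕ → ℝ} (hf : ∀ k, 0 ≤ f k) (d : ℕ) :
    ∏ k ∈ Finset.range d, (1 + M * f k) ≤ Real.exp (M * ∑ k ∈ Finset.range d, f k) := by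
  rw [Finset.mul_sum, Real.exp_sum]
  refine Finset.prod_le_prod (fun k _ => ?_) fun k _ => ?_
  · have := mul_nonneg hM (hf k)
    linarith
  · rw [add_comm]
    exact Real.add_one_le_exp _

namespace ComplexityBounds

/-- The univariate problem alone forces the exponent to be at least `2 τ₁`: the counting bound
reads `lam 0 j = O(j ^ (-2 / p))`. -/
theorem two_mul_tauFirst_le (hN : ComplexityBounds lam N) (hP : PropertyP lam)
    (h0 : ∀ j, 0 ≤ lam 0 j) (h1 : ∀ j, lam 0 j ≤ 1) {C p : ℝ} (hp : 0 ≤ p)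
    (h : ∀ ε : ℝ, 0 < ε → ε < 1 → (N ε 1 : ℝ) ≤ C * ε⁻¹ ^ p) : 2 * tauFirst lam ≤ p := by
  suffices hτ : ∀ τ, p / 2 < τ → tauFirst lam ≤ τ by
    have := le_of_forall_gt_imp_ge_of_dense hτ
    linarith
  intro τ hτ
  have hτ0 : 0 < τ := by linarith
  refine csInf_le ⟨0, fun x hx => hx.1.le⟩ ⟨hτ0, ?_⟩
  -- An exponent strictly between `p` and `2 τ` is positive, which `p` itself need not be.
  obtain ⟨q, hpq, hqτ⟩ := exists_between (show p < 2 * τ by linarith)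
  have hq : 0 < q := by linarith
  have hkey : ∀ j, lam 0 j ^ (q / 2) ≤ |C| * 2 ^ q * ((j + 1 : ℕ) : ℝ)⁻¹ := by
    intro j
    rcases (h0 j).eq_or_lt with hj | hj
    · rw [← hj, Real.zero_rpow (by positivity)]
      positivity
    · -- Any `ε` below `√(lam 0 j)` counts the first `j + 1` eigenvalues; half of it costs `2 ^ q`.
      set ε := √(lam 0 j) / 2 with hε
      have hsq : 0 < √(lam 0 j) := Real.sqrt_pos.2 hj
      have hε0 : 0 < ε := by positivity
      have hs1 : √(lam 0 j) ≤ 1 := Real.sqrt_le_one.2 (h1 j)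
      have hε1 : ε < 1 := by
        rw [hε]
        linarith
      have hε2 : ε ^ 2 < lam 0 j := by
        rw [hε, div_pow, Real.sq_sqrt hj.le]
        linarith
      have h1 : ((j + 1 : ℕ) : ℝ) ≤ |C| * ε⁻¹ ^ q := by
        calc ((j + 1 : ℕ) : ℝ) ≤ N ε 1 := by exact_mod_cast hN.succ_le ε hε0 hε1 j hε2
          _ ≤ C * ε⁻¹ ^ p := h ε hε0 hε1
          _ ≤ |C| * ε⁻¹ ^ p := by
            gcongr
            exact le_abs_self C
          _ ≤ |C| * ε⁻¹ ^ q := by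
            gcongr
            exact (one_le_inv₀ hε0).2 hε1.le
      have h2 : ε⁻¹ ^ q = 2 ^ q * (lam 0 j ^ (q / 2))⁻¹ := by
        rw [hε, inv_div, Real.div_rpow zero_le_two hsq.le, Real.sqrt_eq_rpow,
          ← Real.rpow_mul hj.le, div_eq_mul_inv, show 1 / 2 * q = q / 2 by ring]
      have hpos : 0 < lam 0 j ^ (q / 2) := Real.rpow_pos_of_pos hj _
      rw [h2, ← mul_assoc, ← div_eq_mul_inv, le_div_iff₀ hpos] at h1
      rw [← div_eq_mul_inv, le_div_iff₀ (by positivity)]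
      linarith
  have hpos : 0 < lam 0 1 := hP.hRatio_eq 0 ▸ (hP.ratio_mem 0).1
  set s := 2 * τ / q with hs
  have hs1 : 1 < s := (one_lt_div hq).2 hqτ
  set D := |C| * 2 ^ q with hD
  have hD0 : 0 ≤ D := by positivity
  have hsum : Summable fun j : ℕ => D ^ s / lam 0 1 ^ τ * (((j + 2 : ℕ) : ℝ) ^ s)⁻¹ :=
    ((summable_nat_add_iff 2).2 (Real.summable_nat_rpow_inv.2 hs1)).mul_left _
  refine (Summable.of_nonneg_of_le
    (fun j => Real.rpow_nonneg (div_nonneg (h0 _) hpos.le) _) (fun j => ?_) hsum).tsum_ofReal_lt_top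
  rw [Real.div_rpow (h0 _) hpos.le, div_mul_eq_mul_div]
  refine div_le_div_of_nonneg_right ?_ (Real.rpow_nonneg hpos.le _)
  have hτs : lam 0 (j + 1) ^ τ = (lam 0 (j + 1) ^ (q / 2)) ^ s := by
    rw [← Real.rpow_mul (h0 _), hs]
    congr 1
    field_simp
  rw [hτs, ← Real.inv_rpow (by positivity), ← Real.mul_rpow hD0 (by positivity)]
  exact Real.rpow_le_rpow (Real.rpow_nonneg (h0 _) _) (hkey (j + 1)) (by positivity)

/-- Choosing `m` coordinates gives `m ln d - O(1) ≤ q ln d + (p m / 2) ln h_d⁻¹`. -/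
theorem div_le_AStar (hN : ComplexityBounds lam N) (hP : PropertyP lam) {C p q : ℝ} (hp : 0 ≤ p)
    (h : ∀ d : ℕ, 1 ≤ d → ∀ ε : ℝ, 0 < ε → ε < 1 → (N ε d : ℝ) ≤ C * (d : ℝ) ^ q * ε⁻¹ ^ p)
    {m : ℕ} (hm : q < m) :
    0 < p * m ∧ ((2 * (m - q) / (p * m) : ℝ) : EReal) ≤ AStar lam := by
  obtain ⟨c, hc⟩ := eventually_mul_log_le_log_choose m
  have key : ∀ᶠ d : ℕ in atTop, (m - q) * Real.log d - (c + Real.log C + p) ≤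
      p * m / 2 * Real.log (hRatio lam (d - 1))⁻¹ := by
    filter_upwards [hc, eventually_ge_atTop 1, eventually_ge_atTop m] with d hd hd1 hdm
    set l := Real.log (hRatio lam (d - 1))⁻¹ with hl
    have hl0 : 0 ≤ l := hP.log_inv_nonneg _
    -- The summand `1` makes `ε ^ 2 < h ^ m` strict; it only affects the constant.
    set ε := Real.exp (-(l * m / 2 + 1)) with hε
    have hlm : 0 ≤ l * m := by positivity
    have hε0 : 0 < ε := Real.exp_pos _
    have hε1 : ε < 1 := by
      rw [hε, Real.exp_lt_one_iff]
      linarith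
    have hεm : ε ^ 2 < hRatio lam (d - 1) ^ m := by
      rw [hP.pow_eq_exp, hε, ← Real.exp_nat_mul, Real.exp_lt_exp, ← hl]
      push_cast
      linarith
    have h1 : (d.choose m : ℝ) ≤ C * (d : ℝ) ^ q * ε⁻¹ ^ p :=
      le_trans (by exact_mod_cast hN.choose_le d hd1 ε hε0 hε1 m hεm) (h d hd1 ε hε0 hε1)
    have hch : (0 : ℝ) < d.choose m := by exact_mod_cast Nat.choose_pos hdm
    have hd0 : (0 : ℝ) < d := by exact_mod_cast hd1
    have hdq : 0 < (d : ℝ) ^ q := Real.rpow_pos_of_pos hd0 _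
    have hεp : 0 < ε⁻¹ ^ p := Real.rpow_pos_of_pos (inv_pos.2 hε0) _
    have hC : 0 < C := by
      by_contra! hC
      have : C * (d : ℝ) ^ q * ε⁻¹ ^ p ≤ 0 :=
        mul_nonpos_of_nonpos_of_nonneg (mul_nonpos_of_nonpos_of_nonneg hC hdq.le) hεp.le
      linarith
    have h2 := Real.log_le_log hch h1
    rw [Real.log_mul (by positivity) hεp.ne', Real.log_mul hC.ne' hdq.ne', Real.log_rpow hd0,
      Real.log_rpow (inv_pos.2 hε0), hε, ← Real.exp_neg, Real.log_exp] at h2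
    nlinarith
  have hpm : 0 < p * m := by
    by_contra! hpm
    have hpm0 : p * m = 0 := le_antisymm hpm (by positivity)
    have := le_of_eventually_mul_log_le (a := m - q) (b := 0) (c := c + Real.log C + p) (by
      filter_upwards [key] with d hd
      rw [hpm0] at hd
      linarith)
    linarith
  refine ⟨hpm, le_AStar (c := (c + Real.log C + p) / (p * m / 2)) ?_⟩
  filter_upwards [key] with d hd
  rw [show 2 * (m - q) / (p * m) * Real.log d - (c + Real.log C + p) / (p * m / 2) =
    ((m - q) * Real.log d - (c + Real.log C + p)) / (p * m / 2) by field_simp,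
    div_le_iff₀ (by positivity)]
  linarith

/-- If `ln h_d⁻¹ ≥ a ln d` with `a τ > 1`, then `h_k ^ τ` is summable. -/
theorem exists_sptBound (hN : ComplexityBounds lam N) (hP : PropertyP lam) {x : ℝ}
    (hx : 2 * tauZero lam < x) (hxA : ((2 / x : ℝ) : EReal) < AStar lam) :
    ∃ C : ℝ, 0 ≤ C ∧ SPTBound N C x := by
  obtain ⟨τ', hτ', hdom, hlt⟩ :=
    exists_dominated_lt hP (show tauZero lam < x / 2 by linarith)
  have hx0 : 0 < x := by linarith
  obtain ⟨M, hM, hle⟩ := hN.le τ' hτ' hdom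
  obtain ⟨a, ha, haA⟩ := EReal.lt_iff_exists_real_btwn.1 hxA
  have ha' : 2 / x < a := by exact_mod_cast ha
  have hax : 1 < a * (x / 2) := by
    rw [div_lt_iff₀ hx0] at ha'
    linarith
  have hsum : Summable fun k => hRatio lam k ^ (x / 2) := by
    have hdec : Summable fun k : ℕ => (((k + 1 : ℕ) : ℝ) ^ (a * (x / 2)))⁻¹ :=
      (summable_nat_add_iff 1).2 (Real.summable_nat_rpow_inv.2 hax)
    refine hdec.of_norm_bounded_eventually_nat ?_
    filter_upwards [(tendsto_add_atTop_nat 1).eventually (eventually_mul_log_le_of_lt_AStar haA)]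
      with k hk
    have hk0 : (0 : ℝ) < ((k + 1 : ℕ) : ℝ) := by positivity
    rw [Real.norm_of_nonneg (Real.rpow_nonneg (hP.ratio_mem k).1.le _), hP.rpow_eq_exp,
      Real.rpow_def_of_pos hk0, ← Real.exp_neg, Real.exp_le_exp]
    rw [Nat.add_sub_cancel] at hk
    nlinarith
  refine ⟨Real.exp (M * ∑' k, hRatio lam k ^ (x / 2)), (Real.exp_pos _).le,
    fun d hd ε hε hε1 => ?_⟩
  have hnn : ∀ k, 0 ≤ hRatio lam k ^ (x / 2) := fun k =>
    Real.rpow_nonneg (hP.ratio_mem k).1.le _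
  refine (hle (x / 2) hlt.le d hd ε hε hε1).trans ?_
  rw [mul_div_cancel₀ x two_ne_zero, mul_comm]
  have : 0 ≤ ε⁻¹ ^ x := Real.rpow_nonneg (inv_nonneg.2 hε.le) _
  gcongr
  refine (prod_one_add_le_exp hM hnn d).trans ?_
  gcongr
  exact hsum.sum_le_tsum _ fun k _ => hnn k

end ComplexityBounds

end Polynomial

/-! ### Quasi-polynomial tractability -/

section QuasiPolynomial

variable {lam : ℕ → ℕ → ℝ} {N : ℝ → ℕ → ℕ}

namespace ComplexityBounds

theorem one_le (hN : ComplexityBounds lam N) {d : ℕ} (hd : 1 ≤ d) {ε : ℝ} (hε : 0 < ε)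
    (hε1 : ε < 1) : 1 ≤ N ε d := by
  have := hN.choose_le d hd ε hε hε1 0 (by nlinarith)
  simpa using this

/-- If `ln h_k⁻¹ ≤ L` for all `k`, then with `m` chosen coordinates and `ε ≈ exp (-m L / 2)` the
growth in `d` gives `m ≤ t (2 + m L / 2)`; now let `m → ∞`. -/
theorem two_div_le_of_qptBound (hN : ComplexityBounds lam N) (hP : PropertyP lam) {C t : ℝ}
    (hC : 0 < C) (ht : 0 < t) (h : QPTBound N C t) {L : ℝ}
    (hL : ∀ k, Real.log (hRatio lam k)⁻¹ ≤ L) : 2 / t ≤ L := by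
  have hL0 : 0 ≤ L := (hP.log_inv_nonneg 0).trans (hL 0)
  have key : ∀ m : ℕ, (m : ℝ) ≤ t * (2 + m * L / 2) := by
    intro m
    obtain ⟨c, hc⟩ := eventually_mul_log_le_log_choose m
    refine le_of_eventually_mul_log_le (c := c + Real.log C + t * (2 + m * L / 2)) ?_
    filter_upwards [hc, eventually_ge_atTop 1, eventually_ge_atTop m] with d hd hd1 hdm
    set ε := Real.exp (-(m * L / 2 + 1)) with hε
    have hmL : 0 ≤ m * L := by positivity
    have hε0 : 0 < ε := Real.exp_pos _
    have hε1 : ε < 1 := by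
      rw [hε, Real.exp_lt_one_iff]
      linarith
    have hεm : ε ^ 2 < hRatio lam (d - 1) ^ m := by
      rw [hP.pow_eq_exp, hε, ← Real.exp_nat_mul, Real.exp_lt_exp]
      have : Real.log (hRatio lam (d - 1))⁻¹ * m ≤ L * m :=
        mul_le_mul_of_nonneg_right (hL _) (Nat.cast_nonneg m)
      push_cast
      linarith
    have h1 : (d.choose m : ℝ) ≤
        C * Real.exp (t * (1 + Real.log d) * (1 + Real.log ε⁻¹)) :=
      le_trans (by exact_mod_cast hN.choose_le d hd1 ε hε0 hε1 m hεm) (h d hd1 ε hε0 hε1)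
    have hch : (0 : ℝ) < d.choose m := by exact_mod_cast Nat.choose_pos hdm
    have h2 := Real.log_le_log hch h1
    rw [Real.log_mul hC.ne' (Real.exp_pos _).ne', Real.log_exp, hε, ← Real.exp_neg,
      Real.log_exp] at h2
    linarith
  rw [div_le_iff₀ ht]
  by_contra! hlt
  obtain ⟨m, hm⟩ := exists_nat_gt (2 * t / (1 - L * t / 2))
  rw [div_lt_iff₀ (by linarith)] at hm
  linarith [key m]

theorem two_div_le (hN : ComplexityBounds lam N) (hP : PropertyP lam) {B : EReal}
    (hB : Tendsto (fun k : ℕ => ((Real.log (hRatio lam k)⁻¹ : ℝ) : EReal)) atTop (𝓝 B))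
    {C t : ℝ} (hC : 0 < C) (ht : 0 < t) (h : QPTBound N C t) : ((2 / t : ℝ) : EReal) ≤ B := by
  by_contra! hlt
  obtain ⟨L, hBL, hLt⟩ := EReal.lt_iff_exists_real_btwn.1 hlt
  have hmono : Monotone fun k : ℕ => ((Real.log (hRatio lam k)⁻¹ : ℝ) : EReal) :=
    fun a b hab => EReal.coe_le_coe_iff.2 (hP.log_inv_mono hab)
  have := hN.two_div_le_of_qptBound hP hC ht h (L := L) fun k =>
    EReal.coe_le_coe_iff.1 ((hmono.ge_of_tendsto hB k).trans hBL.le)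
  exact absurd (EReal.coe_le_coe_iff.2 this) (not_le.2 hLt)

/-- The exponent in the Markov bound has to grow with the dimension: for `τ = (t / 2) (1 + ln d)`
all but finitely many factors have `h_k ^ τ ≤ 1 / d`. -/
theorem exists_qptBound (hN : ComplexityBounds lam N) (hP : PropertyP lam) {B : EReal}
    (hB : Tendsto (fun k : ℕ => ((Real.log (hRatio lam k)⁻¹ : ℝ) : EReal)) atTop (𝓝 B))
    {t : ℝ} (ht : 2 * tauZero lam < t) (htB : ((2 / t : ℝ) : EReal) < B) :
    ∃ C : ℝ, 0 < C ∧ QPTBound N C t := by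
  obtain ⟨τ', hτ', hdom, hlt⟩ :=
    exists_dominated_lt hP (show tauZero lam < t / 2 by linarith)
  have ht0 : 0 < t := by linarith
  obtain ⟨M, hM, hle⟩ := hN.le τ' hτ' hdom
  obtain ⟨k₀, hk₀⟩ := eventually_atTop.1 (hB.eventually (lt_mem_nhds htB))
  refine ⟨Real.exp (M * (k₀ + 1)), Real.exp_pos _, fun d hd ε hε hε1 => ?_⟩
  have hd0 : (0 : ℝ) < d := by exact_mod_cast hd
  have hlogd : 0 ≤ Real.log d := Real.log_natCast_nonneg d
  set τ := t / 2 * (1 + Real.log d) with hτ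
  have hτt : t / 2 ≤ τ := le_mul_of_one_le_right (by positivity) (by linarith)
  have hnn : ∀ k, 0 ≤ hRatio lam k ^ τ := fun k => Real.rpow_nonneg (hP.ratio_mem k).1.le _
  have hterm : ∀ k, hRatio lam k ^ τ ≤ (if k < k₀ then 1 else 0) + (d : ℝ)⁻¹ := by
    intro k
    split_ifs with hk
    · have := hP.rpow_le_one k (τ := τ) (by positivity)
      have : (0 : ℝ) < (d : ℝ)⁻¹ := inv_pos.2 hd0
      linarith
    · have h1 : 2 / t < Real.log (hRatio lam k)⁻¹ := by exact_mod_cast hk₀ k (not_lt.1 hk)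
      have h2 : 1 + Real.log d ≤ Real.log (hRatio lam k)⁻¹ * τ := by
        calc 1 + Real.log d = 2 / t * τ := by
              rw [hτ]
              field_simp
          _ ≤ _ := mul_le_mul_of_nonneg_right h1.le (by positivity)
      rw [zero_add, hP.rpow_eq_exp, ← Real.exp_log (inv_pos.2 hd0),
        Real.log_inv (d : ℝ), Real.exp_le_exp]
      linarith
  have hsum : ∑ k ∈ Finset.range d, hRatio lam k ^ τ ≤ k₀ + 1 := by
    refine (Finset.sum_le_sum fun k _ => hterm k).trans ?_
    rw [Finset.sum_add_distrib, Finset.sum_const, Finset.card_range, nsmul_eq_mul,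
      mul_inv_cancel₀ hd0.ne']
    gcongr
    rw [Finset.sum_boole]
    have : ((Finset.range d).filter (· < k₀)).card ≤ (Finset.range k₀).card :=
      Finset.card_le_card fun k hk => by simp_all
    rw [Finset.card_range] at this
    exact_mod_cast this
  refine (hle τ (hlt.le.trans hτt) d hd ε hε hε1).trans ?_
  rw [mul_comm]
  have h1 : ∏ k ∈ Finset.range d, (1 + M * hRatio lam k ^ τ) ≤ Real.exp (M * (k₀ + 1)) :=
    (prod_one_add_le_exp hM hnn d).trans (by gcongr)
  have h2 : ε⁻¹ ^ (2 * τ) ≤ Real.exp (t * (1 + Real.log d) * (1 + Real.log ε⁻¹)) := by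
    rw [Real.rpow_def_of_pos (inv_pos.2 hε), Real.exp_le_exp, hτ]
    have : 0 ≤ t * (1 + Real.log d) := by positivity
    linarith
  have h3 : 0 ≤ ε⁻¹ ^ (2 * τ) := Real.rpow_nonneg (inv_nonneg.2 hε.le) _
  exact mul_le_mul h1 h2 h3 (Real.exp_pos _).le

end ComplexityBounds

end QuasiPolynomial

/-! ### Weak tractability and the curse of dimensionality -/

section Weak

variable {lam : ℕ → ℕ → ℝ} {N : ℝ → ℕ → ℕ}

theorem eventually_jointLimit :
    ∀ᶠ x : ℝ × ℕ in jointLimit, 0 < x.1 ∧ x.1 < 1 ∧ 1 ≤ x.2 :=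
  mem_inf_of_right (mem_principal_self _)

/-- `max ε⁻¹ d` tends to infinity along with `ε⁻¹ + d`, whatever the exponents. -/
theorem tendsto_rpow_add_rpow_jointLimit {s t : ℝ} (hs : 0 < s) (ht : 0 < t) :
    Tendsto (fun x : ℝ × ℕ => x.1⁻¹ ^ s + (x.2 : ℝ) ^ t) jointLimit atTop := by
  refine tendsto_atTop.2 fun R => ?_
  obtain ⟨K, hKs, hKt, hK⟩ := ((tendsto_rpow_atTop hs).eventually_ge_atTop R |>.and
    ((tendsto_rpow_atTop ht).eventually_ge_atTop R |>.and (eventually_ge_atTop 0))).exists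
  have hlim : Tendsto (fun x : ℝ × ℕ => x.1⁻¹ + (x.2 : ℝ)) jointLimit atTop :=
    tendsto_comap.mono_left inf_le_left
  filter_upwards [hlim.eventually_ge_atTop (2 * K), eventually_jointLimit] with x hx hx'
  have h1 : 0 ≤ x.1⁻¹ ^ s := Real.rpow_nonneg (inv_nonneg.2 hx'.1.le) _
  have h2 : 0 ≤ (x.2 : ℝ) ^ t := Real.rpow_nonneg (Nat.cast_nonneg _) _
  rcases le_total K x.1⁻¹ with h | h
  · linarith [Real.rpow_le_rpow hK h hs.le]
  · linarith [Real.rpow_le_rpow hK (show K ≤ (x.2 : ℝ) by linarith) ht.le]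

/-- For weak tractability it is enough to bound `ln n(ε, S_d)` up to additive constants. -/
theorem stwt_of_forall_exists_log_le {s t : ℝ} (hs : 0 < s) (ht : 0 < t)
    (h : ∀ δ : ℝ, 0 < δ → ∃ K : ℝ, ∀ d : ℕ, 1 ≤ d → ∀ ε : ℝ, 0 < ε → ε < 1 →
      Real.log (N ε d) ≤ δ * (ε⁻¹ ^ s + (d : ℝ) ^ t) + K) : STWT N s t := by
  have hlim := tendsto_rpow_add_rpow_jointLimit hs ht
  refine Metric.tendsto_nhds.2 fun r hr => ?_
  obtain ⟨K, hK⟩ := h (r / 2) (by positivity)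
  filter_upwards [hlim.eventually_gt_atTop 0, hlim.eventually_gt_atTop (2 * K / r),
    eventually_jointLimit] with x h0 h1 hx
  have hlog := Real.log_natCast_nonneg (N x.1 x.2)
  rw [Real.dist_0_eq_abs, abs_of_nonneg (div_nonneg hlog h0.le), div_lt_iff₀ h0]
  rw [div_lt_iff₀ hr] at h1
  linarith [hK x.2 hx.2.2 x.1 hx.1 hx.2.1]

/-- The monotonicity of `f` bounds it on the compact range where `f ≤ δ g` may fail. -/
theorem exists_le_mul_add_of_isLittleO {f g : ℝ → ℝ} (hf : MonotoneOn f (Set.Ici 1))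
    (hg : ∀ x, 1 ≤ x → 0 ≤ g x) (hfg : f =o[atTop] g) {δ : ℝ} (hδ : 0 < δ) :
    ∃ K : ℝ, 0 ≤ K ∧ ∀ x, 1 ≤ x → f x ≤ δ * g x + K := by
  obtain ⟨R, hR⟩ := eventually_atTop.1 (hfg.bound hδ)
  refine ⟨|f (max R 1)|, abs_nonneg _, fun x hx => ?_⟩
  have hgx := hg x hx
  rcases le_total R x with h | h
  · have h1 := hR x h
    rw [Real.norm_of_nonneg hgx] at h1
    linarith [Real.le_norm_self (f x), abs_nonneg (f (max R 1))]
  · have h1 : f x ≤ f (max R 1) :=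
      hf hx (Set.mem_Ici.2 (le_max_right _ _)) (h.trans (le_max_left _ _))
    linarith [le_abs_self (f (max R 1)), mul_nonneg hδ.le hgx]

theorem isLittleO_one_add_log_sq {s : ℝ} (hs : 0 < s) :
    (fun x : ℝ => (1 + Real.log x) ^ 2) =o[atTop] fun x : ℝ => x ^ s := by
  have h1 : (fun x : ℝ => 1 + Real.log x) =o[atTop] fun x : ℝ => x ^ (s / 2) := by
    refine Asymptotics.IsLittleO.add ?_ (isLittleO_log_rpow_atTop (by positivity))
    exact Asymptotics.isLittleO_const_left.2
      (Or.inr (tendsto_norm_atTop_atTop.comp (tendsto_rpow_atTop (by positivity))))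
  refine (h1.mul h1).congr' (Eventually.of_forall fun x => (pow_two _).symm) ?_
  filter_upwards [eventually_gt_atTop 0] with x hx
  rw [← Real.rpow_add hx, add_halves]

theorem monotoneOn_log_Ici : MonotoneOn Real.log (Set.Ici 1) := fun _ hx _ _ hxy =>
  Real.log_le_log (zero_lt_one.trans_le hx) hxy

theorem monotoneOn_one_add_log_sq :
    MonotoneOn (fun x : ℝ => (1 + Real.log x) ^ 2) (Set.Ici 1) := fun _ hx _ hy hxy =>
  pow_le_pow_left₀ (add_nonneg zero_le_one (Real.log_nonneg hx))
    (add_le_add le_rfl (monotoneOn_log_Ici hx hy hxy)) 2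

/-- By `2 (1 + ln d) (1 + ln ε⁻¹) ≤ (1 + ln d) ^ 2 + (1 + ln ε⁻¹) ^ 2`. -/
theorem QPT.stwt (h : QPT N) (h1 : ∀ d : ℕ, 1 ≤ d → ∀ ε : ℝ, 0 < ε → ε < 1 → 1 ≤ N ε d)
    {s t : ℝ} (hs : 0 < s) (ht : 0 < t) : STWT N s t := by
  obtain ⟨C, p, hC, hp, h⟩ := h
  refine stwt_of_forall_exists_log_le hs ht fun δ hδ => ?_
  have hδp : 0 < 2 * δ / p := by positivity
  obtain ⟨K₁, -, hK₁⟩ := exists_le_mul_add_of_isLittleO monotoneOn_one_add_log_sq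
    (fun x hx => Real.rpow_nonneg (zero_le_one.trans hx) _) (isLittleO_one_add_log_sq hs) hδp
  obtain ⟨K₂, -, hK₂⟩ := exists_le_mul_add_of_isLittleO monotoneOn_one_add_log_sq
    (fun x hx => Real.rpow_nonneg (zero_le_one.trans hx) _) (isLittleO_one_add_log_sq ht) hδp
  refine ⟨Real.log C + p / 2 * (K₁ + K₂), fun d hd ε hε hε1 => ?_⟩
  have hN : (0 : ℝ) < N ε d := by exact_mod_cast h1 d hd ε hε hε1
  have h2 := Real.log_le_log hN (h d hd ε hε hε1)
  rw [Real.log_mul hC.ne' (Real.exp_pos _).ne', Real.log_exp] at h2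
  have h3 := hK₁ ε⁻¹ ((one_le_inv₀ hε).2 hε1.le)
  have h4 := hK₂ d (by exact_mod_cast hd)
  have h5 := two_mul_le_add_sq (1 + Real.log d) (1 + Real.log ε⁻¹)
  calc Real.log (N ε d)
      ≤ Real.log C + p / 2 * (2 * (1 + Real.log d) * (1 + Real.log ε⁻¹)) := by linarith
    _ ≤ Real.log C + p / 2 * ((2 * δ / p * (d : ℝ) ^ t + K₂) +
          (2 * δ / p * ε⁻¹ ^ s + K₁)) := by
        gcongr
        linarith
    _ = δ * (ε⁻¹ ^ s + (d : ℝ) ^ t) + (Real.log C + p / 2 * (K₁ + K₂)) := by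
        field_simp
        ring

namespace ComplexityBounds

/-- The Markov bound for one fixed exponent is `ln n(ε, S_d) ≤ 2 τ ln ε⁻¹ + M d`, and
`M d = o(d ^ t)`. -/
theorem stwt_of_one_lt (hN : ComplexityBounds lam N) (hP : PropertyP lam) {s t : ℝ}
    (hs : 0 < s) (ht : 1 < t) : STWT N s t := by
  obtain ⟨τ, hτ, hdom⟩ := hP.dominated
  obtain ⟨M, hM, hle⟩ := hN.le τ hτ hdom
  refine stwt_of_forall_exists_log_le hs (by linarith) fun δ hδ => ?_
  obtain ⟨K₁, -, hK₁⟩ := exists_le_mul_add_of_isLittleO monotoneOn_log_Ici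
    (fun x hx => Real.rpow_nonneg (zero_le_one.trans hx) _) (isLittleO_log_rpow_atTop hs)
    (show 0 < δ / (2 * τ) by positivity)
  have hlin : (fun x : ℝ => M * x) =o[atTop] fun x : ℝ => x ^ t := by
    have h1 : (fun _ : ℝ => M) =o[atTop] fun x : ℝ => x ^ (t - 1) :=
      Asymptotics.isLittleO_const_left.2
        (Or.inr (tendsto_norm_atTop_atTop.comp (tendsto_rpow_atTop (sub_pos.2 ht))))
    refine (h1.mul_isBigO (Asymptotics.isBigO_refl (fun x : ℝ => x) _)).congr' .rfl ?_
    filter_upwards [eventually_gt_atTop 0] with x hx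
    rw [← Real.rpow_add_one hx.ne', sub_add_cancel]
  obtain ⟨K₂, -, hK₂⟩ := exists_le_mul_add_of_isLittleO
    (fun x _ y _ hxy => mul_le_mul_of_nonneg_left hxy hM)
    (fun x hx => Real.rpow_nonneg (zero_le_one.trans hx) _) hlin hδ
  refine ⟨2 * τ * K₁ + K₂, fun d hd ε hε hε1 => ?_⟩
  have hεpos : 0 < ε⁻¹ ^ (2 * τ) := Real.rpow_pos_of_pos (inv_pos.2 hε) _
  have h1 : (N ε d : ℝ) ≤ ε⁻¹ ^ (2 * τ) * Real.exp (M * d) := by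
    refine (hle τ le_rfl d hd ε hε hε1).trans ?_
    gcongr
    refine (prod_one_add_le_exp hM (fun k => Real.rpow_nonneg (hP.ratio_mem k).1.le _) d).trans ?_
    gcongr
    calc ∑ k ∈ Finset.range d, hRatio lam k ^ τ ≤ ∑ _k ∈ Finset.range d, (1 : ℝ) :=
          Finset.sum_le_sum fun k _ => hP.rpow_le_one k hτ.le
      _ = d := by simp
  have h2 := Real.log_le_log (by exact_mod_cast hN.one_le hd hε hε1) h1
  rw [Real.log_mul hεpos.ne' (Real.exp_pos _).ne', Real.log_exp,
    Real.log_rpow (inv_pos.2 hε)] at h2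
  have h3 := hK₁ ε⁻¹ ((one_le_inv₀ hε).2 hε1.le)
  have h4 := hK₂ d (by exact_mod_cast hd)
  calc Real.log (N ε d) ≤ 2 * τ * Real.log ε⁻¹ + M * d := h2
    _ ≤ 2 * τ * (δ / (2 * τ) * ε⁻¹ ^ s + K₁) + (δ * (d : ℝ) ^ t + K₂) := by gcongr
    _ = δ * (ε⁻¹ ^ s + (d : ℝ) ^ t) + (2 * τ * K₁ + K₂) := by
        field_simp
        ring

/-- If `h ≡ 1`, then `n(ε, S_d) ≥ 2 ^ d`, so that for fixed `ε` the quotient stays above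
`ln 2 / (ε ^ (-s) + 1)`. -/
theorem not_forall_eq_one_of_stwt (hN : ComplexityBounds lam N) {s t : ℝ} (ht : t ≤ 1)
    (h : STWT N s t) : ¬ ∀ k, hRatio lam k = 1 := by
  intro hone
  obtain ⟨ε, hε, hε1⟩ := exists_between (zero_lt_one' ℝ)
  have hseq : Tendsto (fun d : ℕ => (ε, d)) atTop jointLimit := by
    refine tendsto_inf.2 ⟨tendsto_comap_iff.2 ?_, tendsto_principal.2 ?_⟩
    · exact tendsto_atTop_add_const_left _ ε⁻¹ tendsto_natCast_atTop_atTop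
    · filter_upwards [eventually_ge_atTop 1] with d hd
      exact ⟨hε, hε1, hd⟩
  have hlog2 : 0 < Real.log 2 := Real.log_pos one_lt_two
  set a : ℝ := ε⁻¹ ^ s with ha
  have ha0 : 0 < a := by positivity
  have hlim : Tendsto (fun d : ℕ => Real.log (N ε d) / (a + (d : ℝ) ^ t)) atTop (𝓝 0) := by
    unfold STWT at h
    simpa only [Function.comp_def] using h.comp hseq
  obtain ⟨d, hd, hd1⟩ := ((hlim.eventually (gt_mem_nhds
    (show 0 < Real.log 2 / (a + 1) by positivity))).and (eventually_ge_atTop 1)).exists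
  have hd1' : (1 : ℝ) ≤ d := by exact_mod_cast hd1
  have hdt : (d : ℝ) ^ t ≤ d := by
    simpa using Real.rpow_le_rpow_of_exponent_le hd1' ht
  have hdt0 : 0 ≤ (d : ℝ) ^ t := Real.rpow_nonneg (by positivity) _
  have hNd : (d : ℝ) * Real.log 2 ≤ Real.log (N ε d) := by
    rw [← Real.log_pow]
    refine Real.log_le_log (by positivity) ?_
    exact_mod_cast hN.two_pow_le hone d hd1 ε hε hε1
  rw [div_lt_div_iff₀ (by positivity) (by positivity)] at hd
  have h1 : (d : ℝ) * Real.log 2 * (a + 1) < Real.log 2 * (a + d) :=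
    (mul_le_mul_of_nonneg_right hNd (by positivity)).trans_lt
      (hd.trans_le (by gcongr))
  nlinarith [mul_nonneg (mul_nonneg hlog2.le ha0.le) (sub_nonneg.2 hd1')]

theorem curse_of_forall_eq_one (hN : ComplexityBounds lam N) (hone : ∀ k, hRatio lam k = 1) :
    CurseOfDimensionality N := by
  refine ⟨1, 1 / 2, 1, one_pos, by norm_num, one_pos, fun ε hε hε2 => ?_⟩
  refine Eventually.frequently ?_
  filter_upwards [eventually_ge_atTop 1] with d hd
  have : (2 : ℝ) ^ d ≤ N ε d := by
    exact_mod_cast hN.two_pow_le hone d hd ε hε (by linarith)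
  norm_num
  exact this

end ComplexityBounds

/-- For fixed `ε`, quasi-polynomial tractability is a polynomial bound in `d`. -/
theorem QPT.not_curse (h : QPT N) : ¬ CurseOfDimensionality N := by
  rintro ⟨C', ε₀, α, hC', hε₀, hα, hcurse⟩
  obtain ⟨C, t, hC, ht, h⟩ := h
  set ε := min ε₀ (1 / 2) with hε
  have hε0 : 0 < ε := by positivity
  have hε1 : ε < 1 := (min_le_right _ _).trans_lt (by norm_num)
  set b := t * (1 + Real.log ε⁻¹) with hb
  have hb0 : 0 ≤ b := by
    have := Real.log_nonneg ((one_le_inv₀ hε0).2 hε1.le)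
    positivity
  have hlittle := (isLittleO_pow_const_const_pow_of_one_lt (R := ℝ) ⌈b⌉₊
    (show 1 < 1 + α by linarith)).bound
    (show 0 < C' / (2 * (C * Real.exp b)) by positivity)
  obtain ⟨d, hd, hd2, hd1⟩ := ((hcurse ε hε0 (min_le_left _ _)).and_eventually
    (hlittle.and (eventually_ge_atTop 1))).exists
  have hd0 : (1 : ℝ) ≤ d := by exact_mod_cast hd1
  have h1 : Real.exp (t * (1 + Real.log d) * (1 + Real.log ε⁻¹)) ≤
      Real.exp b * (d : ℝ) ^ ⌈b⌉₊ := by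
    calc Real.exp (t * (1 + Real.log d) * (1 + Real.log ε⁻¹)) = Real.exp b * (d : ℝ) ^ b := by
          rw [Real.rpow_def_of_pos (by linarith), ← Real.exp_add]
          congr 1
          rw [hb]
          ring
      _ ≤ Real.exp b * (d : ℝ) ^ ⌈b⌉₊ := by
          gcongr
          rw [← Real.rpow_natCast]
          exact Real.rpow_le_rpow_of_exponent_le hd0 (Nat.le_ceil _)
  have hα0 : 0 < (1 + α) ^ d := by positivity
  rw [Real.norm_of_nonneg (by positivity), Real.norm_of_nonneg hα0.le, div_mul_eq_mul_div,
    le_div_iff₀ (by positivity)] at hd2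
  have h2 : C' * (1 + α) ^ d ≤ C * (Real.exp b * (d : ℝ) ^ ⌈b⌉₊) :=
    (hd.trans (h d hd1 ε hε0 hε1)).trans (by gcongr)
  nlinarith [mul_pos hC' hα0]

end Weak

end TensorTractability

theorem theorem2p1 {𝕜 : Type u} [RCLike 𝕜]
    (P : TensorProductProblem.{u, v, w} 𝕜)
    (lam : ℕ → ℕ → ℝ) (η : ∀ k, ℕ → P.H k)
    (hlam : ∀ k, IsEigenSystem (P.W k) (lam k) (η k))
    (hP : PropertyP lam) :
    ∃ B : EReal,
      Tendsto (fun k : ℕ => ((Real.log (hRatio lam k)⁻¹ : ℝ) : EReal)) atTop (𝓝 B) ∧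
      (0 < B ↔ ¬ ∀ k, hRatio lam k = 1) ∧
      ∀ c : Criterion,
        -- strong polynomial tractability and its exponent
        (SPT (P.complexity c) ↔ 0 < AStar lam) ∧
        (SPT (P.complexity c) →
          max (2 / AStar lam) ((2 * tauFirst lam : ℝ) : EReal) ≤
            (sptExponent (P.complexity c) : EReal) ∧
          (sptExponent (P.complexity c) : EReal) ≤
            max (2 / AStar lam) ((2 * tauZero lam : ℝ) : EReal) ∧
          (tauZero lam = tauFirst lam →
            (sptExponent (P.complexity c) : EReal) =
              max (2 / AStar lam) ((2 * tauZero lam : ℝ) : EReal))) ∧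
        -- polynomial tractability
        (SPT (P.complexity c) ↔ PT (P.complexity c)) ∧
        -- quasi-polynomial tractability and its exponent
        (QPT (P.complexity c) ↔ 0 < B) ∧
        (QPT (P.complexity c) →
          max (2 / B) ((2 * tauFirst lam : ℝ) : EReal) ≤
            (qptExponent (P.complexity c) : EReal) ∧
          (qptExponent (P.complexity c) : EReal) ≤
            max (2 / B) ((2 * tauZero lam : ℝ) : EReal) ∧
          (tauZero lam = tauFirst lam →
            (qptExponent (P.complexity c) : EReal) =
              max (2 / B) ((2 * tauZero lam : ℝ) : EReal))) ∧
        -- the weak notions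
        (QPT (P.complexity c) ↔ UWT (P.complexity c)) ∧
        (∀ s t : ℝ, 0 < s → 0 < t → t ≤ 1 →
          (QPT (P.complexity c) ↔ STWT (P.complexity c) s t)) ∧
        (QPT (P.complexity c) ↔ WT (P.complexity c)) ∧
        (∀ s t : ℝ, 0 < s → 1 < t → STWT (P.complexity c) s t) ∧
        -- the curse of dimensionality
        (CurseOfDimensionality (P.complexity c) ↔ ∀ k, hRatio lam k = 1) := by
  obtain ⟨B, hB, hB1⟩ := hP.exists_tendsto_log_inv
  refine ⟨B, hB, hB1, fun c => ?_⟩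
  have hN := P.complexityBounds hlam hP c
  have h0 : ∀ j, 0 ≤ lam 0 j := (hlam 0).nonneg
  have h1 : ∀ j, lam 0 j ≤ 1 := hP.le_one (fun k => (hlam k).antitone) 0
  have hex : ∀ A : EReal, 0 < A → ∃ x : ℝ, 2 * tauZero lam < x ∧ ((2 / x : ℝ) : EReal) < A := by
    intro A hA
    obtain ⟨a, ha0, haA⟩ := EReal.lt_iff_exists_real_btwn.1 hA
    have ha0' : 0 < a := by exact_mod_cast ha0
    have hτ := tauZero_nonneg lam
    refine ⟨2 * tauZero lam + 2 / a, lt_add_of_pos_right _ (by positivity), ?_⟩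
    refine lt_of_le_of_lt (EReal.coe_le_coe_iff.2 ?_) haA
    rw [div_le_iff₀ (by positivity), mul_add, mul_div_cancel₀ _ ha0'.ne']
    linarith [mul_nonneg ha0'.le hτ]
  have hPT : ∀ C p q : ℝ, 0 ≤ p → (∀ d : ℕ, 1 ≤ d → ∀ ε : ℝ, 0 < ε → ε < 1 →
      (P.complexity c ε d : ℝ) ≤ C * (d : ℝ) ^ q * ε⁻¹ ^ p) → 0 < AStar lam := by
    intro C p q hp h
    obtain ⟨m, hm⟩ := exists_nat_gt q
    obtain ⟨hpm, hA⟩ := hN.div_le_AStar hP hp h hm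
    refine lt_of_lt_of_le (EReal.coe_pos.2 ?_) hA
    have := sub_pos.2 hm
    positivity
  have hSPT : ∀ C p : ℝ, 0 ≤ p → SPTBound (P.complexity c) C p →
      0 < p ∧ ((2 / p : ℝ) : EReal) ≤ AStar lam := by
    intro C p hp h
    have := hN.div_le_AStar hP (C := C) (q := 0) (m := 1) hp (fun d hd ε hε hε1 => by
      simpa using h d hd ε hε hε1) (by norm_num)
    simpa using this
  have hSPT_iff : SPT (P.complexity c) ↔ 0 < AStar lam := by
    constructor
    · rintro ⟨C, p, -, hp, h⟩
      obtain ⟨hp0, hA⟩ := hSPT C p hp h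
      exact lt_of_lt_of_le (EReal.coe_pos.2 (by positivity)) hA
    · intro hA
      obtain ⟨x, hx, hxA⟩ := hex _ hA
      obtain ⟨C, hC, h⟩ := hN.exists_sptBound hP hx hxA
      exact ⟨C, x, hC, by linarith [tauZero_nonneg lam], h⟩
  have hQPT_iff : QPT (P.complexity c) ↔ 0 < B := by
    constructor
    · rintro ⟨C, t, hC, ht, h⟩
      exact lt_of_lt_of_le (EReal.coe_pos.2 (by positivity)) (hN.two_div_le hP hB hC ht h)
    · intro hB0
      obtain ⟨t, ht, htB⟩ := hex _ hB0
      obtain ⟨C, hC, h⟩ := hN.exists_qptBound hP hB ht htB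
      exact ⟨C, t, hC, by linarith [tauZero_nonneg lam], h⟩
  have hstwt : QPT (P.complexity c) → ∀ s t : ℝ, 0 < s → 0 < t → STWT (P.complexity c) s t :=
    fun h s t hs ht => h.stwt (fun d hd ε hε hε1 => hN.one_le hd hε hε1) hs ht
  have hstwt' : ∀ s t : ℝ, t ≤ 1 → STWT (P.complexity c) s t → QPT (P.complexity c) :=
    fun s t ht h => hQPT_iff.2 (hB1.2 (hN.not_forall_eq_one_of_stwt ht h))
  have hWT : WT (P.complexity c) ↔ STWT (P.complexity c) 1 1 := by
    simp only [WT, STWT, Real.rpow_one]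
  refine ⟨hSPT_iff, fun h => ?_, ⟨?_, ?_⟩, hQPT_iff, fun h => ?_, ⟨?_, ?_⟩, ?_, ?_, ?_, ?_, ?_⟩
  · refine sInf_bounds (hSPT_iff.1 h) (tauZero_nonneg lam) ?_ ?_ ?_ ?_ ?_
    · obtain ⟨C, p, hC, hp, h⟩ := h
      exact ⟨p, hp, C, hC, h⟩
    · rintro p ⟨hp, C, hC, h⟩
      exact hN.two_mul_tauFirst_le hP h0 h1 hp (h 1 le_rfl)
    · rintro p ⟨hp, C, hC, h⟩
      exact (hSPT C p hp h).1
    · rintro p ⟨hp, C, hC, h⟩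
      exact (hSPT C p hp h).2
    · intro x hx hxA
      exact ⟨by linarith [tauZero_nonneg lam], hN.exists_sptBound hP hx hxA⟩
  · rintro ⟨C, p, hC, hp, h⟩
    exact ⟨C, p, 0, hC, hp, le_rfl, fun d hd ε hε hε1 => by simpa using h d hd ε hε hε1⟩
  · rintro ⟨C, p, q, hC, hp, hq, h⟩
    exact hSPT_iff.2 (hPT C p q hp h)
  · refine sInf_bounds (hQPT_iff.1 h) (tauZero_nonneg lam) ?_ ?_ ?_ ?_ ?_
    · obtain ⟨C, t, hC, ht, h⟩ := h
      exact ⟨t, ht, C, hC, h⟩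
    · rintro t ⟨ht, C, hC, h⟩
      refine hN.two_mul_tauFirst_le hP h0 h1 (C := C * Real.exp t) ht.le fun ε hε hε1 => ?_
      have := h 1 le_rfl ε hε hε1
      rw [Real.rpow_def_of_pos (inv_pos.2 hε), mul_assoc, ← Real.exp_add]
      convert this using 3
      simp
      ring
    · exact fun t ht => ht.1
    · rintro t ⟨ht, C, hC, h⟩
      exact hN.two_div_le hP hB hC ht h
    · intro t ht htB
      exact ⟨by linarith [tauZero_nonneg lam], hN.exists_qptBound hP hB ht htB⟩
  · exact fun h s t hs ht => hstwt h s t hs ht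
  · exact fun h => hstwt' 1 1 le_rfl (h 1 1 one_pos one_pos)
  · exact fun s t hs ht ht1 => ⟨fun h => hstwt h s t hs ht, hstwt' s t ht1⟩
  · rw [hWT]
    exact ⟨fun h => hstwt h 1 1 one_pos one_pos, hstwt' 1 1 le_rfl⟩
  · exact fun s t hs ht => hN.stwt_of_one_lt hP hs ht
  · intro h
    by_contra hne
    exact (hQPT_iff.2 (hB1.2 hne)).not_curse h
  · exact hN.curse_of_forall_eq_one
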